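/- Consider a discrete-time system of $N\ge 1$ parallel queues with one server and slots $t=0,1,2,\dots$. At each slot boundary $t$, $A_j(t)\in\{0,1\}$ packets arrive at queue $j$; the $A_j(t)$ are independent over $j$ and $t$, with $P(A_j(t)=1)=\lambda_j$. One queue is scheduled in each slot, without knowledge of the unobserved backlogs, and the backlogs evolve by $Q_j(t+1)=(Q_j(t)-D_j(t))^+ +A_j(t+1)$, where $D_j(t)=1$ if $j$ is scheduled in slot $t$ and $D_j(t)=0$ otherwise. Let $V_j(t)$ be the number of slots since queue $j$ was last scheduled ($V_j(t)=0$ if $j$ was scheduled in slot $t-1$), so that $Q_j(t-V_j(t))$ is its last observed backlog. For $K\ge1$, the $K$-limited policy $\pi_K$ (KLEQ) keeps serving the queue under service as long as it is nonempty and its current service period has lasted fewer than $K$ slots; otherwise it starts a new service period of at least one slot at the queue $$\arg\max_{1\le i\le N}\bigl[\,Q_i(t-V_i(t))+\lambda_iV_i(t)\,\bigr]$$ (possibly the same queue), ties being broken by a fixed rule applied to the vector of these $N$ values. The triple of backlogs, last observed backlogs and ages $V$, together with the queue under service and the number of slots used in its service period, is a countable Markov chain $X(t)$. Its states are those with at most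 $K$ slots used and $Q_i(t)-Q_i(t-V_i(t))\in\{0,\dots,V_i(t)\}$ for all $i$, this difference being $0$ if $\lambda_i=0$. For a function $f$ of the state, call a state $y$ *essential for $f$* if from every state accessible from $y$ the chain can reach a state where $f$ has the value $f(y)$. Call $f(X(t))$ *positive recurrent* if (i) from every initial state, the mean of the first time $t\ge1$ at which $X(t)$ is essential for $f$ is finite, and (ii) whenever a value $a$ of $f$ can be reached from every state accessible from $x$, the mean of the first time $t\ge1$ with $f(X(t))=a$, starting at $x$, is finite. (For an irreducible chain and $f=\mathrm{id}$ this is ordinary positive recurrence.) **Proposition.** For every $K\ge1$ and every $\boldsymbol\lambda\in\mathbb R_{\ge0}^N$ with $\sum_{i=1}^N\lambda_i<1$, the policy $\pi_K$ is stabilizing: from every initial state, the mean of the first time $t\ge1$ with $Q(t)=0$ is finite; the backlog process $Q(t)$ is positive recurrent; and the Markov chain $X(t)$, with the ages $V_i$ of those queues that have $\lambda_i=0$ left out, is positive recurrent. -/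

import Mathlib

open MeasureTheory ProbabilityTheory
open scoped ENNReal

namespace KLEQ

/-! ### Recurrence of a time-homogeneous chain

`X x n ω` is the position at time `n` of the chain started at `x`; `S` is thought of as countable
and discrete. -/

/-- The mean of the first time `n ≥ 1` at which the chain started at `x` is in `E`
(the first time is `∞` if there is none). -/
noncomputable def meanReturnTime {Ω S : Type*} [MeasurableSpace Ω] (μ : Measure Ω)
    (X : S → ℕ → Ω → S) (x : S) (E : Set S) : ℝ≥0∞ :=
  ∫⁻ ω, (⨅ n : ℕ, ⨅ _ : 1 ≤ n ∧ X x n ω ∈ E, (n : ℝ≥0∞)) ∂μ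

/-- The set `E` is accessible from `x`. -/
def CanReach {Ω S : Type*} [MeasurableSpace Ω] (μ : Measure Ω)
    (X : S → ℕ → Ω → S) (x : S) (E : Set S) : Prop :=
  ∃ n : ℕ, 0 < μ {ω | X x n ω ∈ E}

/-- `E` is accessible from every state that is accessible from `x`. -/
def StaysReachable {Ω S : Type*} [MeasurableSpace Ω] (μ : Measure Ω)
    (X : S → ℕ → Ω → S) (x : S) (E : Set S) : Prop :=
  ∀ y : S, CanReach μ X x {y} → CanReach μ X y E

/-- Positive recurrence of the process `f (X x n)`, for starting points `x` in `space`, without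
assuming irreducibility. A state `y` is essential (for `f`) if the value `f y` stays reachable
from `y`. The set of essential states is entered in finite mean time from everywhere, and every
value that stays reachable from `x` is hit, or returned to, in finite mean time from `x`; in
particular every essential value has a finite mean recurrence time. For an irreducible chain and
`f = id` this is the usual positive recurrence. -/
def PositiveRecurrent {Ω S α : Type*} [MeasurableSpace Ω] (μ : Measure Ω)
    (X : S → ℕ → Ω → S) (space : Set S) (f : S → α) : Prop :=
  (∀ x ∈ space, meanReturnTime μ X x {y | StaysReachable μ X y {z | f z = f y}} < ∞) ∧
  ∀ x ∈ space, ∀ a : α, StaysReachable μ X x {z | f z = a} →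
    meanReturnTime μ X x {z | f z = a} < ∞

/-! ### The queueing system under the `K`-limited policy -/

/-- The state of the system at the beginning of a slot `t`. -/
structure State (N : ℕ) where
  /-- the backlogs `Q i (t)` -/
  backlog : Fin N → ℕ
  /-- the last observed backlogs `Q i (t - V i (t))` -/
  seen : Fin N → ℕ
  /-- `V i (t)`, the number of slots since queue `i` was last allowed to transmit;
  it is `0` if `i` was allowed to transmit in slot `t - 1` -/
  age : Fin N → ℕ
  /-- the queue scheduled in slot `t - 1` -/
  incumbent : Fin N
  /-- the number of slots of the current service period that have been used so far -/
  served : ℕ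

/-- The expected backlog `Q i (t - V i (t)) + lam i * V i (t)`. -/
noncomputable def State.index {N : ℕ} (lam : Fin N → ℝ) (s : State N) (i : Fin N) : ℝ :=
  (s.seen i : ℝ) + lam i * (s.age i : ℝ)

/-- `pick` selects a maximizing coordinate of every vector, ties being broken in a fixed way. -/
def IsArgmax {N : ℕ} (pick : (Fin N → ℝ) → Fin N) : Prop :=
  ∀ (h : Fin N → ℝ) (i : Fin N), h i ≤ h (pick h)

/-- The incumbent keeps the server if it is nonempty and has been served for fewer than `K` slots.
(The backlog of the incumbent at `t` has just been observed.) -/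
def State.Keeps {N : ℕ} (K : ℕ) (s : State N) : Prop :=
  0 < s.seen s.incumbent ∧ s.served < K

open Classical in
/-- The queue that the policy schedules in the slot; it depends on the backlogs only through what
has been observed. -/
noncomputable def State.scheduled {N : ℕ} (K : ℕ) (lam : Fin N → ℝ)
    (pick : (Fin N → ℝ) → Fin N) (s : State N) : Fin N :=
  if s.Keeps K then s.incumbent else pick (s.index lam)

/-- The backlogs at the beginning of the next slot, `(Q i - D i)⁺ + a i`, if queue `j` is scheduled
and the arrivals at the next slot boundary are `a`. -/
def State.nextBacklog {N : ℕ} (s : State N) (j : Fin N) (a : Fin N → ℕ) (i : Fin N) : ℕ :=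
  (s.backlog i - if i = j then 1 else 0) + a i

open Classical in
/-- One slot under the policy, with arrivals `a` at the next slot boundary. A service period that
ends because the incumbent is empty or has used its `K` slots is followed by a new one, possibly
at the same queue. -/
noncomputable def State.step {N : ℕ} (K : ℕ) (lam : Fin N → ℝ) (pick : (Fin N → ℝ) → Fin N)
    (s : State N) (a : Fin N → ℕ) : State N where
  backlog := s.nextBacklog (s.scheduled K lam pick) a
  seen i := if i = s.scheduled K lam pick
    then s.nextBacklog (s.scheduled K lam pick) a i else s.seen i
  age i := if i = s.scheduled K lam pick then 0 else s.age i + 1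
  incumbent := s.scheduled K lam pick
  served := if s.Keeps K then s.served + 1 else 1

/-- The state at time `t` when the state at time `0` is `x` and `A t j` is the number of arrivals
to queue `j` at the slot boundary `t`. -/
noncomputable def chain {Ω : Type*} {N : ℕ} (K : ℕ) (lam : Fin N → ℝ)
    (pick : (Fin N → ℝ) → Fin N) (A : ℕ → Fin N → Ω → ℕ) (x : State N) : ℕ → Ω → State N
  | 0, _ => x
  | t + 1, ω => (chain K lam pick A x t ω).step K lam pick fun j => A (t + 1) j ω

/-- The arrivals `A t j` are independent over slots and queues, and Bernoulli with rate `lam j`. -/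
structure IsBernoulliArrivals {Ω : Type*} [MeasurableSpace Ω] {N : ℕ} (μ : Measure Ω)
    (lam : Fin N → ℝ) (A : ℕ → Fin N → Ω → ℕ) : Prop where
  measurable : ∀ t j, Measurable (A t j)
  indep : iIndepFun (fun p : ℕ × Fin N => A p.1 p.2) μ
  le_one : ∀ t j, ∀ᵐ ω ∂μ, A t j ω ≤ 1
  prob_one : ∀ t j, μ {ω | A t j ω = 1} = ENNReal.ofReal (lam j)

/-- The state space: since queue `i` was last observed, `V i` slot boundaries have passed, so that
`backlog i - seen i` is a possible value of the number of arrivals at `V i` boundaries. All ages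
and all last observations are allowed. A state with `served = K` is one in which a new queue is
about to be chosen; such states serve also as initial states without an incumbent. -/
def stateSpace {N : ℕ} (K : ℕ) (lam : Fin N → ℝ) : Set (State N) :=
  {s | s.served ≤ K ∧ ∀ i, s.seen i ≤ s.backlog i ∧ s.backlog i ≤ s.seen i + s.age i ∧
    (lam i = 0 → s.backlog i = s.seen i)}

open Classical in
/-- The state without the ages of the queues that never receive an arrival. (Such an age has no
influence on the policy, and it can grow forever.) -/
noncomputable def State.essentialPart {N : ℕ} (lam : Fin N → ℝ) (s : State N) : State N :=
  { s with age := fun i => if lam i = 0 then 0 else s.age i }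

/-- Stability of the system under the policy. From every state the mean time of (the first return
to) an empty system is finite, the backlog process `Q(t)` is positive recurrent, and so is the
Markov chain that consists of the backlogs and the variables on which the policy bases its
decisions. -/
def IsStable {Ω : Type*} [MeasurableSpace Ω] {N : ℕ} (μ : Measure Ω) (K : ℕ) (lam : Fin N → ℝ)
    (pick : (Fin N → ℝ) → Fin N) (A : ℕ → Fin N → Ω → ℕ) : Prop :=
  (∀ x ∈ stateSpace K lam,
    meanReturnTime μ (chain K lam pick A) x {s | s.backlog = 0} < ∞) ∧
  PositiveRecurrent μ (chain K lam pick A) (stateSpace K lam) State.backlog ∧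
  PositiveRecurrent μ (chain K lam pick A) (stateSpace K lam) (State.essentialPart lam)

end KLEQ

/-! Given the observations, the numbers of unobserved arrivals are independent binomial variables,
and the policy decides without looking at them. The drift is therefore computed not at a single
state but after averaging over these gaps; `avg_transOp` says that the averaging may be renewed
after every step. Under the average, the backlog of queue i has mean `index i` and variance λ_i (1 -
λ_i) V_i, which is at most its index.

Let r = 1 - ∑ λ_i and let M be the largest index. The averaged drift of the sum of squared backlogs
is at most 2N + 2(1 - r)M - 2J, where J is the index of the scheduled queue. When a service period
opens, J = M and the bound is 2N - 2rM. During a period, J may fall short of M, but at most by the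
`deficit`. The Lyapunov function adds 2(K - served) · deficit, which prepays this loss for the
remaining slots. Opening a period at queue j creates a prepayment of at most 2K(2 + (M - Q_j)⁺).
Since M is the mean of Q_j, the difference x is a pure fluctuation of variance at most M, and 2K|x|
≤ K²/r + r x² bounds its mean cost by K²/r + rM. Half of the negative drift survives
(`avg_transOp_lyapunov_le`).

Hence the time until M is below `driftLevel` has a finite averaged mean (`avg_truncHit_le`). Each
state of the state space has positive weight in its own average, so the mean is finite at the state
itself (`meanHit_maxIndex_lt_top`). Within the state space this level set is finite up to irrelevant
ages, and repeated trials from it reach any set that stays accessible in finite mean time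
(`meanHit_lt_top_of_finite`). Only accessibility remains: the empty system is reached along a path
without arrivals, on which a potential decreases (`exists_reach_empty`), and essential states are
found by minimality in the finite set of classes (`exists_reach_essential`). -/

namespace KLEQ

/-! ### Hitting times of a chain driven by i.i.d. inputs -/

section Driven

variable {S α : Type*} [MeasurableSpace α]

/-- The transition operator of the chain that moves from `s` to `step s a` with `a` of law `π`. -/
noncomputable def transOp (π : Measure α) (step : S → α → S) (f : S → ℝ≥0∞) (s : S) : ℝ≥0∞ :=
  ∫⁻ a, f (step s a) ∂π

/-- The transition operator of the chain killed when it enters `E`. -/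
noncomputable def killOp (π : Measure α) (step : S → α → S) (E : Set S) (f : S → ℝ≥0∞) : S → ℝ≥0∞ :=
  transOp π step (Eᶜ.indicator f)

/-- The probability that `E` is not entered at the times `1, …, n`. -/
noncomputable def avoidProb (π : Measure α) (step : S → α → S) (E : Set S) (n : ℕ) : S → ℝ≥0∞ :=
  (killOp π step E)^[n] 1

/-- The mean of the first time `n ≥ 1` in `E`. -/
noncomputable def meanHit (π : Measure α) (step : S → α → S) (E : Set S) (s : S) : ℝ≥0∞ :=
  ∑' n, avoidProb π step E n s

/-- The mean of the minimum of `k` and the first time `n ≥ 1` in `E`. -/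
noncomputable def truncHit (π : Measure α) (step : S → α → S) (E : Set S) (k : ℕ) (s : S) : ℝ≥0∞ :=
  ∑ n ∈ Finset.range k, avoidProb π step E n s

/-- `t` is a possible successor of `s`. -/
def Succ (π : Measure α) (step : S → α → S) (s t : S) : Prop :=
  ∃ a, π {a} ≠ 0 ∧ step s a = t

variable {π : Measure α} {step : S → α → S} {E C R : Set S}

theorem avoidProb_succ (n : ℕ) :
    avoidProb π step E (n + 1) = killOp π step E (avoidProb π step E n) :=
  Function.iterate_succ_apply' _ _ _

theorem meanHit_le_of_truncHit_le {s : S} {c : ℝ≥0∞} (h : ∀ k, truncHit π step E k s ≤ c) :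
    meanHit π step E s ≤ c := by
  rw [meanHit, ENNReal.tsum_eq_iSup_nat]
  exact iSup_le h

theorem truncHit_mono {j k : ℕ} (h : j ≤ k) (s : S) :
    truncHit π step E j s ≤ truncHit π step E k s :=
  Finset.sum_le_sum_of_subset (Finset.range_subset_range.2 h)

theorem transOp_const [IsProbabilityMeasure π] (c : ℝ≥0∞) (s : S) :
    transOp π step (fun _ => c) s = c := by
  simp [transOp]

theorem transOp_mono {f g : S → ℝ≥0∞} (h : ∀ s, f s ≤ g s) (s : S) :
    transOp π step f s ≤ transOp π step g s :=
  lintegral_mono fun _ => h _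

theorem transOp_mono_of_closed [Countable α] (hR : ∀ s ∈ R, ∀ t, Succ π step s t → t ∈ R)
    {f g : S → ℝ≥0∞} (h : ∀ s ∈ R, f s ≤ g s) {s : S} (hs : s ∈ R) :
    transOp π step f s ≤ transOp π step g s := by
  refine lintegral_mono_ae ((ae_iff_of_countable).2 fun a ha => ?_)
  exact h _ (hR s hs _ ⟨a, ha, rfl⟩)

theorem killOp_mono_of_closed [Countable α] (hR : ∀ s ∈ R, ∀ t, Succ π step s t → t ∈ R)
    {f g : S → ℝ≥0∞} (h : ∀ s ∈ R, f s ≤ g s) {s : S} (hs : s ∈ R) :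
    killOp π step E f s ≤ killOp π step E g s := by
  refine transOp_mono_of_closed hR (fun t ht => ?_) hs
  by_cases hE : t ∈ E <;> simp [hE, h t ht]

theorem killOp_le_transOp (f : S → ℝ≥0∞) (s : S) : killOp π step E f s ≤ transOp π step f s :=
  transOp_mono (fun t => Set.indicator_le_self _ _ t) s

theorem avoidProb_le_one [IsProbabilityMeasure π] (n : ℕ) (s : S) :
    avoidProb π step E n s ≤ 1 := by
  induction n generalizing s with
  | zero => simp [avoidProb]
  | succ n ih =>
    rw [avoidProb_succ]
    exact (killOp_le_transOp _ _).trans ((transOp_mono ih s).trans (transOp_const _ _).le)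

theorem avoidProb_antitone [IsProbabilityMeasure π] (s : S) :
    Antitone fun n => avoidProb π step E n s := by
  refine antitone_nat_of_succ_le fun n => ?_
  induction n generalizing s with
  | zero => simpa [avoidProb] using avoidProb_le_one (π := π) (step := step) (E := E) 1 s
  | succ n ih =>
    rw [avoidProb_succ n, avoidProb_succ (n + 1)]
    exact transOp_mono (fun t => Set.indicator_le_indicator (ih t)) s

/-- Two states that are identified by a compatible equivalence have the same mean hitting times of
saturated sets. -/
theorem avoidProb_congr {β : Type*} {e : S → β}
    (he : ∀ s t, e s = e t → ∀ a, e (step s a) = e (step t a))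
    (hE : ∀ s t, e s = e t → s ∈ E → t ∈ E) (n : ℕ) {s t : S} (hst : e s = e t) :
    avoidProb π step E n s = avoidProb π step E n t := by
  induction n generalizing s t with
  | zero => rfl
  | succ n ih =>
    rw [avoidProb_succ]
    refine lintegral_congr fun a => ?_
    have h := he s t hst a
    by_cases hs : step s a ∈ E
    · simp [hs, hE _ _ h hs]
    · have ht : step t a ∉ E := fun ht => hs (hE _ _ h.symm ht)
      simp [hs, ht, ih h]

theorem iterate_killOp_mono_of_closed [Countable α]
    (hR : ∀ s ∈ R, ∀ t, Succ π step s t → t ∈ R)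
    {f g : S → ℝ≥0∞} (h : ∀ s ∈ R, f s ≤ g s) (n : ℕ) :
    ∀ s ∈ R, (killOp π step E)^[n] f s ≤ (killOp π step E)^[n] g s := by
  induction n with
  | zero => exact h
  | succ n ih =>
    intro s hs
    rw [Function.iterate_succ_apply', Function.iterate_succ_apply']
    exact killOp_mono_of_closed hR ih hs

/-- If `E` were inaccessible, all avoidance probabilities would be 1 and their sum infinite. Thus
the drift bound yields accessibility of the level set without an explicit path. -/
theorem exists_reflTransGen_of_meanHit_lt_top {s : S} [Countable α] [IsProbabilityMeasure π]
    (h : meanHit π step E s < ∞) : ∃ t ∈ E, Relation.ReflTransGen (Succ π step) s t := by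
  by_contra! hcon
  have key : ∀ n, ∀ t, Relation.ReflTransGen (Succ π step) s t → avoidProb π step E n t = 1 := by
    intro n
    induction n with
    | zero => intro t _; rfl
    | succ n ih =>
      intro t ht
      rw [avoidProb_succ, killOp, ← transOp_const (π := π) (step := step) 1 t]
      refine lintegral_congr_ae ((ae_iff_of_countable).2 fun a ha => ?_)
      have hr := ht.tail ⟨a, ha, rfl⟩
      have hE : step t a ∈ Eᶜ := fun hE => hcon _ hE hr
      simp only [Set.indicator_of_mem hE, ih _ hr]
  refine h.ne ?_
  rw [meanHit, tsum_congr fun n => key n s .refl]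
  simp

variable [DiscreteMeasurableSpace α]

theorem transOp_add (f g : S → ℝ≥0∞) (s : S) :
    transOp π step (fun t => f t + g t) s = transOp π step f s + transOp π step g s :=
  lintegral_add_left .of_discrete _

theorem transOp_mul_const (f : S → ℝ≥0∞) (c : ℝ≥0∞) (s : S) :
    transOp π step (fun t => f t * c) s = transOp π step f s * c :=
  lintegral_mul_const _ .of_discrete

theorem killOp_add (f g : S → ℝ≥0∞) (s : S) :
    killOp π step E (fun t => f t + g t) s = killOp π step E f s + killOp π step E g s := by
  rw [killOp, killOp, killOp, ← transOp_add]
  exact congrArg (fun h => transOp π step h s) (Set.indicator_add _ _ _)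

theorem truncHit_succ (k : ℕ) (s : S) :
    truncHit π step E (k + 1) s = 1 + killOp π step E (truncHit π step E k) s := by
  induction k with
  | zero => simp [truncHit, avoidProb, killOp, transOp, Set.indicator]
  | succ k ih =>
    have h1 : truncHit π step E (k + 1 + 1) s
        = truncHit π step E (k + 1) s + avoidProb π step E (k + 1) s := Finset.sum_range_succ _ _
    have h2 : truncHit π step E (k + 1)
        = fun t => truncHit π step E k t + avoidProb π step E k t := by
      ext t; exact Finset.sum_range_succ _ _
    rw [h1, ih, h2, killOp_add, avoidProb_succ, add_assoc]

/-- First-step analysis; both sides may be infinite. -/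
theorem meanHit_eq_one_add (s : S) :
    meanHit π step E s = 1 + killOp π step E (meanHit π step E) s := by
  rw [meanHit, tsum_eq_zero_add' ENNReal.summable]
  congr 1
  have : Eᶜ.indicator (meanHit π step E)
      = fun t => ∑' n, Eᶜ.indicator (avoidProb π step E n) t := by
    ext t
    by_cases ht : t ∈ E <;> simp [ht, meanHit]
  rw [killOp, this, transOp, lintegral_tsum fun n => Measurable.of_discrete.aemeasurable]
  exact tsum_congr fun n => by rw [avoidProb_succ]; rfl

/-- By first-step analysis, the successors outside `C` contribute at most the present mean; those
inside contribute at most `b`. -/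
theorem transOp_meanHit_le [Countable α] [IsProbabilityMeasure π]
    (hR : ∀ s ∈ R, ∀ t, Succ π step s t → t ∈ R)
    {b : ℝ≥0∞} (hb : ∀ s ∈ R, s ∈ C → meanHit π step C s ≤ b) {s : S} (hs : s ∈ R) :
    transOp π step (meanHit π step C) s ≤ meanHit π step C s + b := by
  calc transOp π step (meanHit π step C) s
      ≤ transOp π step (fun t => Cᶜ.indicator (meanHit π step C) t + b) s := by
        refine transOp_mono_of_closed hR (fun t ht => ?_) hs
        by_cases hC : t ∈ C <;> simp [hC, hb t ht]
    _ = killOp π step C (meanHit π step C) s + b := by rw [transOp_add, transOp_const]; rfl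
    _ ≤ meanHit π step C s + b := by
        gcongr
        rw [meanHit_eq_one_add]
        exact le_add_self

/-- The strong Markov property at the first visit to `C`, obtained by induction on the truncation
level. Truncation keeps the quantities finite for the later absorption argument. -/
theorem truncHit_le_add [Countable α] [IsProbabilityMeasure π]
    (hR : ∀ s ∈ R, ∀ t, Succ π step s t → t ∈ R) {G : ℝ≥0∞} (k : ℕ)
    (hG : ∀ s ∈ R, s ∈ C → truncHit π step E k s ≤ G) :
    ∀ s ∈ R, truncHit π step E k s ≤ meanHit π step C s + G := by
  induction k with
  | zero => intro s _; simp [truncHit]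
  | succ k ih =>
    have hG' : ∀ s ∈ R, s ∈ C → truncHit π step E k s ≤ G := fun s hs hC =>
      (truncHit_mono k.le_succ s).trans (hG s hs hC)
    intro s hs
    calc truncHit π step E (k + 1) s = 1 + killOp π step E (truncHit π step E k) s :=
          truncHit_succ k s
      _ ≤ 1 + transOp π step (fun t => Cᶜ.indicator (meanHit π step C) t + G) s := by
          gcongr
          refine (killOp_le_transOp _ _).trans (transOp_mono_of_closed hR (fun t ht => ?_) hs)
          by_cases hC : t ∈ C
          · simpa [hC] using hG' t ht hC
          · simpa [hC] using ih hG' t ht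
      _ = meanHit π step C s + G := by
          rw [transOp_add, transOp_const, meanHit_eq_one_add, add_assoc]; rfl

/-- First-step analysis iterated `n` times. Monotonicity in the truncation level allows the same `k`
on both sides. -/
theorem truncHit_le_add_iterate [Countable α] [IsProbabilityMeasure π] (k n : ℕ) (s : S) :
    truncHit π step E k s ≤ n + (killOp π step E)^[n] (truncHit π step E k) s := by
  induction n generalizing s with
  | zero => simp
  | succ n ih =>
    calc truncHit π step E k s ≤ truncHit π step E (k + 1) s := truncHit_mono k.le_succ s
      _ = 1 + killOp π step E (truncHit π step E k) s := truncHit_succ k s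
      _ ≤ 1 + killOp π step E
            (fun t => n + (killOp π step E)^[n] (truncHit π step E k) t) s := by
          gcongr
          exact killOp_mono_of_closed (R := Set.univ) (fun _ _ _ _ => trivial)
            (fun t _ => ih t) trivial
      _ ≤ (n + 1 : ℕ) + (killOp π step E)^[n + 1] (truncHit π step E k) s := by
          rw [killOp_add, Function.iterate_succ_apply', ← add_assoc, Nat.cast_succ,
            add_comm (n : ℝ≥0∞)]
          gcongr
          exact (killOp_le_transOp _ _).trans (transOp_const _ _).le

theorem iterate_killOp_add_const [Countable α] (f : S → ℝ≥0∞) (c : ℝ≥0∞) (n : ℕ) (s : S) :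
    (killOp π step E)^[n] (fun t => f t + c) s
      = (killOp π step E)^[n] f s + avoidProb π step E n s * c := by
  induction n generalizing s with
  | zero => simp [avoidProb]
  | succ n ih =>
    rw [Function.iterate_succ_apply', Function.iterate_succ_apply', avoidProb_succ, funext ih,
      killOp_add]
    congr 1
    rw [killOp, killOp, ← transOp_mul_const]
    refine congrArg (fun h => transOp π step h s) ?_
    ext t
    by_cases ht : t ∈ E <;> simp [ht]

theorem iterate_killOp_meanHit_le [Countable α] [IsProbabilityMeasure π]
    (hR : ∀ s ∈ R, ∀ t, Succ π step s t → t ∈ R)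
    {b : ℝ≥0∞} (hb : ∀ s ∈ R, s ∈ C → meanHit π step C s ≤ b) (n : ℕ) :
    ∀ s ∈ R, (killOp π step E)^[n] (meanHit π step C) s ≤ meanHit π step C s + n * b := by
  induction n with
  | zero => intro s _; simp
  | succ n ih =>
    intro s hs
    rw [Function.iterate_succ_apply']
    calc killOp π step E ((killOp π step E)^[n] (meanHit π step C)) s
        ≤ transOp π step (fun t => meanHit π step C t + n * b) s :=
          (killOp_le_transOp _ _).trans (transOp_mono_of_closed hR ih hs)
      _ ≤ meanHit π step C s + b + n * b := by
          rw [transOp_add, transOp_const]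
          gcongr
          exact transOp_meanHit_le hR hb hs
      _ = meanHit π step C s + (n + 1 : ℕ) * b := by push_cast; ring

/-- If `C` is entered in finite mean time from everywhere, in bounded mean time from `C`, and
if from `C` the set `E` is entered within `n` steps with probability at least `1 - q > 0`,
then `E` is entered in finite mean time from everywhere. -/
theorem meanHit_lt_top_of_trials [Countable α] [IsProbabilityMeasure π]
    (hR : ∀ s ∈ R, ∀ t, Succ π step s t → t ∈ R)
    (hC : ∀ s ∈ R, meanHit π step C s < ∞)
    {b : ℝ≥0∞} (hb' : b < ∞) (hb : ∀ s ∈ R, s ∈ C → meanHit π step C s ≤ b)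
    {n : ℕ} {q : ℝ≥0∞} (hq' : q < 1) (hq : ∀ s ∈ R, s ∈ C → avoidProb π step E n s ≤ q) :
    ∀ s ∈ R, meanHit π step E s < ∞ := by
  set c : ℝ≥0∞ := n + (b + n * b) with hc
  have hc' : c < ∞ := by
    simp only [hc, ENNReal.add_lt_top, ENNReal.natCast_lt_top, true_and]
    exact ⟨hb', ENNReal.mul_lt_top (ENNReal.natCast_lt_top n) hb'⟩
  have key : ∀ k, ∀ s ∈ R, s ∈ C → truncHit π step E k s ≤ c / (1 - q) := by
    intro k
    -- The truncation makes `G` finite, so that `G ≤ c + q * G` can be solved for `G`; the resulting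
    -- bound no longer depends on `k`.
    set G : ℝ≥0∞ := ⨆ s : {s // s ∈ R ∧ s ∈ C}, truncHit π step E k s with hG
    have hGk : G ≤ k := by
      refine iSup_le fun s => ?_
      calc truncHit π step E k s ≤ ∑ n ∈ Finset.range k, (1 : ℝ≥0∞) :=
            Finset.sum_le_sum fun n _ => avoidProb_le_one _ _
        _ = k := by simp
    have hGtop : G ≠ ∞ := ne_top_of_le_ne_top (ENNReal.natCast_ne_top k) hGk
    have hG1 : ∀ s ∈ R, s ∈ C → truncHit π step E k s ≤ G := fun s hs hsC =>
      le_iSup (fun s : {s // s ∈ R ∧ s ∈ C} => truncHit π step E k s) ⟨s, hs, hsC⟩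
    have hG2 : G ≤ c + q * G := by
      refine iSup_le fun ⟨s, hs, hsC⟩ => ?_
      calc truncHit π step E k s
          ≤ n + (killOp π step E)^[n] (truncHit π step E k) s := truncHit_le_add_iterate k n s
        _ ≤ n + (killOp π step E)^[n] (fun t => meanHit π step C t + G) s := by
            gcongr
            exact iterate_killOp_mono_of_closed hR (truncHit_le_add hR k hG1) n s hs
        _ ≤ n + ((b + n * b) + q * G) := by
            rw [iterate_killOp_add_const]
            gcongr
            · exact (iterate_killOp_meanHit_le hR hb n s hs).trans (by gcongr; exact hb s hs hsC)
            · exact hq s hs hsC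
        _ = c + q * G := by rw [hc]; ring
    have hG3 : G ≤ c / (1 - q) := by
      have hq0 : 1 - q ≠ 0 := (tsub_pos_of_lt hq').ne'
      rw [ENNReal.le_div_iff_mul_le (.inl hq0) (.inl (by simp)), ENNReal.mul_sub (fun _ _ => hGtop),
        mul_one, mul_comm G]
      exact tsub_le_iff_right.2 hG2
    exact fun s hs hsC => (hG1 s hs hsC).trans hG3
  intro s hs
  refine (meanHit_le_of_truncHit_le fun k => truncHit_le_add hR k (key k) s hs).trans_lt ?_
  exact ENNReal.add_lt_top.2
    ⟨hC s hs, ENNReal.div_lt_top hc'.ne (tsub_pos_of_lt hq').ne'⟩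

/-- The mean of `1 - f` is positive because one atom contributes, and the means of `f` and `1 - f`
add up to 1. -/
theorem transOp_lt_one [Countable α] [IsProbabilityMeasure π] {f : S → ℝ≥0∞} (hf : ∀ s, f s ≤ 1)
    {s t : S} (hst : Succ π step s t) (ht : f t < 1) : transOp π step f s < 1 := by
  obtain ⟨a, ha, rfl⟩ := hst
  have h1 : transOp π step f s + transOp π step (fun t => 1 - f t) s = 1 := by
    rw [← transOp_add]
    simp only [add_tsub_cancel_of_le (hf _), transOp_const]
  have h2 : transOp π step (fun t => 1 - f t) s ≠ 0 := by
    rw [transOp, Ne, lintegral_eq_zero_iff .of_discrete, Filter.EventuallyEq, ae_iff_of_countable]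
    exact fun h => (tsub_pos_of_lt ht).ne' (h a ha)
  have h3 : transOp π step f s ≠ ∞ := ne_top_of_le_ne_top ENNReal.one_ne_top (h1 ▸ le_self_add)
  calc transOp π step f s < transOp π step f s + transOp π step (fun t => 1 - f t) s :=
        ENNReal.lt_add_right h3 h2
    _ = 1 := h1

theorem exists_avoidProb_lt_one [Countable α] [IsProbabilityMeasure π] {s t : S}
    (h : Relation.TransGen (Succ π step) s t) (ht : t ∈ E) :
    ∃ n, avoidProb π step E n s < 1 := by
  have hle : ∀ n u, Eᶜ.indicator (avoidProb π step E n) u ≤ 1 := fun n u =>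
    (Set.indicator_le_self _ _ u).trans (avoidProb_le_one n u)
  induction h using Relation.TransGen.head_induction_on with
  | single h =>
    refine ⟨1, ?_⟩
    rw [avoidProb_succ]
    exact transOp_lt_one (hle 0) h (by simp [ht])
  | head h _ ih =>
    obtain ⟨n, hn⟩ := ih
    refine ⟨n + 1, ?_⟩
    rw [avoidProb_succ]
    exact transOp_lt_one (hle n) h ((Set.indicator_le_self _ _ _).trans_lt hn)

/-- If `C` is finite up to a compatible equivalence and entered in finite mean time from
everywhere, then so is each saturated set that is accessible from all states of `C`. -/
theorem meanHit_lt_top_of_finite [Countable α] [IsProbabilityMeasure π] {β : Type*} {e : S → β}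
    (he : ∀ s t, e s = e t → ∀ a, e (step s a) = e (step t a))
    (hE : ∀ s t, e s = e t → s ∈ E → t ∈ E) (hCe : ∀ s t, e s = e t → s ∈ C → t ∈ C)
    (hR : ∀ s ∈ R, ∀ t, Succ π step s t → t ∈ R)
    (hC : ∀ s ∈ R, meanHit π step C s < ∞) (hfin : (e '' (R ∩ C)).Finite)
    (hreach : ∀ s ∈ R, s ∈ C → ∃ t ∈ E, Relation.TransGen (Succ π step) s t) :
    ∀ s ∈ R, meanHit π step E s < ∞ := by
  classical
  obtain ⟨F, hF, hFe⟩ := Set.exists_subset_bijOn (R ∩ C) e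
  have hFfin : F.Finite := Set.Finite.of_finite_image (hFe.image_eq ▸ hfin) hFe.injOn
  have hrep : ∀ s ∈ R, s ∈ C → ∃ c ∈ F, e c = e s := fun s hs hsC =>
    hFe.surjOn ⟨s, ⟨hs, hsC⟩, rfl⟩
  have hex : ∀ c ∈ F, ∃ n, avoidProb π step E n c < 1 := fun c hc => by
    obtain ⟨t, htE, ht⟩ := hreach c (hF hc).1 (hF hc).2
    exact exists_avoidProb_lt_one ht htE
  choose! m hm using hex
  lift F to Finset S using hFfin
  -- Avoidance probabilities decrease in time, so the largest of the finitely many individual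
  -- horizons serves all representatives.
  refine meanHit_lt_top_of_trials (b := ∑ c ∈ F, meanHit π step C c) (n := F.sup m)
    (q := F.sup fun c => avoidProb π step E (F.sup m) c) hR hC ?_ ?_ ?_ ?_
  · exact ENNReal.sum_lt_top.2 fun c hc => hC c (hF hc).1
  · intro s hs hsC
    obtain ⟨c, hc, hcs⟩ := hrep s hs hsC
    have : meanHit π step C s = meanHit π step C c :=
      tsum_congr fun n => (avoidProb_congr he hCe n hcs).symm
    rw [this]
    exact Finset.single_le_sum (f := fun c => meanHit π step C c) (fun _ _ => zero_le) hc
  · refine (Finset.sup_lt_iff (by simp)).2 fun c hc => ?_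
    exact (avoidProb_antitone c (Finset.le_sup hc)).trans_lt (hm c hc)
  · intro s hs hsC
    obtain ⟨c, hc, hcs⟩ := hrep s hs hsC
    rw [← avoidProb_congr he hE _ hcs]
    exact Finset.le_sup (f := fun c => avoidProb π step E (F.sup m) c) hc

end Driven

/-! ### From paths to operators: the Markov property of the driven chain -/

section Law

variable {S α Ω : Type*}

/-- The chain started at `x` and driven by the inputs `ξ 1, ξ 2, …`. -/
def drive (step : S → α → S) (ξ : ℕ → Ω → α) (x : S) : ℕ → Ω → S
  | 0, _ => x
  | t + 1, ω => step (drive step ξ x t ω) (ξ (t + 1) ω)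

/-- The paths that avoid `E` at the times `1, …, n`. -/
def avoidSet (X : ℕ → Ω → S) (E : Set S) (n : ℕ) : Set Ω :=
  {ω | ∀ k, 1 ≤ k → k ≤ n → X k ω ∉ E}

/-- A hitting time equals the number of `n ≥ 0` that precede it; if `E` is never hit, both sides are
infinite. -/
theorem iInf_hit_eq_tsum (X : ℕ → Ω → S) (E : Set S) (ω : Ω) :
    (⨅ n : ℕ, ⨅ _ : 1 ≤ n ∧ X n ω ∈ E, (n : ℝ≥0∞))
      = ∑' n, (avoidSet X E n).indicator 1 ω := by
  classical
  by_cases h : ∃ n, 1 ≤ n ∧ X n ω ∈ E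
  · have h1 : (⨅ n : ℕ, ⨅ _ : 1 ≤ n ∧ X n ω ∈ E, (n : ℝ≥0∞)) = Nat.find h := by
      refine le_antisymm (iInf₂_le (Nat.find h) (Nat.find_spec h)) (le_iInf₂ fun n hn => ?_)
      exact_mod_cast Nat.find_min' h hn
    have h2 : ∀ n, (avoidSet X E n).indicator (1 : Ω → ℝ≥0∞) ω
        = if n < Nat.find h then 1 else 0 := by
      intro n
      rw [Set.indicator_apply]
      refine if_congr ?_ rfl rfl
      constructor
      · intro hn
        by_contra! hlt
        exact hn _ (Nat.find_spec h).1 hlt (Nat.find_spec h).2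
      · intro hn k hk hkn hkE
        exact Nat.find_min h (hkn.trans_lt hn) ⟨hk, hkE⟩
    rw [h1, tsum_eq_sum (s := Finset.range (Nat.find h))]
    · rw [Finset.sum_congr rfl fun n hn => (h2 n).trans (if_pos (Finset.mem_range.1 hn))]
      simp
    · intro n hn
      rw [h2, if_neg (by simpa using hn)]
  · push Not at h
    have h2 : ∀ n, (avoidSet X E n).indicator (1 : Ω → ℝ≥0∞) ω = 1 := fun n =>
      Set.indicator_of_mem (show ω ∈ avoidSet X E n from fun k hk _ => h k hk) _
    simp only [h2]
    rw [ENNReal.tsum_const_eq_top_of_ne_zero one_ne_zero, iInf_eq_top]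
    intro n
    rw [iInf_eq_top]
    exact fun hn => absurd hn.2 (h n hn.1)

variable [MeasurableSpace α] {step : S → α → S} {π : Measure α} {ξ : ℕ → Ω → α}

/-- The inputs up to time `n`. -/
abbrev past (ξ : ℕ → Ω → α) (n : ℕ) : MeasurableSpace Ω :=
  ⨆ k ∈ Set.Iic n, MeasurableSpace.comap (ξ k) inferInstance

theorem past_mono : Monotone (past ξ) := fun _ _ h =>
  biSup_mono fun _ hk => le_trans (Set.mem_Iic.1 hk) h

theorem measurable_past (n : ℕ) : Measurable[past ξ n] (ξ n) :=
  Measurable.mono (comap_measurable (ξ n))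
    (le_biSup (fun k => MeasurableSpace.comap (ξ k) inferInstance) (Set.mem_Iic.2 le_rfl)) le_rfl

theorem past_le [MeasurableSpace Ω] (hm : ∀ n, Measurable (ξ n)) (n : ℕ) : past ξ n ≤ ‹MeasurableSpace Ω› :=
  iSup₂_le fun k _ => (hm k).comap_le

section

variable [Countable α] [DiscreteMeasurableSpace α]

theorem iterate_transOp_ne_zero (f : S → ℝ≥0∞) (n : ℕ) (x : S) :
    (transOp π step)^[n] f x ≠ 0 → ∃ y, f y ≠ 0 ∧ Relation.ReflTransGen (Succ π step) x y := by
  induction n generalizing x with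
  | zero => exact fun h => ⟨x, h, .refl⟩
  | succ n ih =>
    rw [Function.iterate_succ_apply', transOp, Ne, lintegral_eq_zero_iff .of_discrete,
      Filter.EventuallyEq, ae_iff_of_countable]
    intro h
    push Not at h
    obtain ⟨a, ha, hne⟩ := h
    obtain ⟨y, hy, hr⟩ := ih _ hne
    exact ⟨y, hy, .head ⟨a, ha, rfl⟩ hr⟩

theorem exists_iterate_transOp_ne_zero (f : S → ℝ≥0∞) {x y : S}
    (h : Relation.ReflTransGen (Succ π step) x y) (hy : f y ≠ 0) :
    ∃ n, (transOp π step)^[n] f x ≠ 0 := by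
  induction h using Relation.ReflTransGen.head_induction_on with
  | refl => exact ⟨0, hy⟩
  | head h _ ih =>
    obtain ⟨n, hn⟩ := ih
    obtain ⟨a, ha, rfl⟩ := h
    refine ⟨n + 1, ?_⟩
    rw [Function.iterate_succ_apply', transOp, Ne, lintegral_eq_zero_iff .of_discrete,
      Filter.EventuallyEq, ae_iff_of_countable]
    exact fun h => hn (h a ha)

end

variable [Countable S] [Countable α] [DiscreteMeasurableSpace α]

theorem measurable_drive (x : S) (n : ℕ) : @Measurable _ _ (past ξ n) ⊤ (drive step ξ x n) := by
  let _ : MeasurableSpace S := ⊤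
  induction n with
  | zero => exact @measurable_const _ _ _ (past ξ 0) x
  | succ n ih =>
    have h1 : Measurable[past ξ (n + 1)] (drive step ξ x n) := ih.mono (past_mono n.le_succ) le_rfl
    have h2 : Measurable[past ξ (n + 1)] fun ω => (drive step ξ x n ω, ξ (n + 1) ω) :=
      h1.prodMk (measurable_past (n + 1))
    exact (Measurable.of_discrete (f := fun p : S × α => step p.1 p.2)).comp h2

theorem measurableSet_avoidSet (x : S) (E : Set S) (n : ℕ) :
    MeasurableSet[past ξ n] (avoidSet (drive step ξ x) E n) := by
  let _ : MeasurableSpace S := ⊤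
  have : avoidSet (drive step ξ x) E n
      = ⋂ k, ⋂ (_ : 1 ≤ k), ⋂ (_ : k ≤ n), drive step ξ x k ⁻¹' Eᶜ := by
    ext ω; simp [avoidSet]
  rw [this]
  refine MeasurableSet.iInter fun k => .iInter fun _ => .iInter fun hk => ?_
  exact past_mono hk _ (measurable_drive x k trivial)

variable [MeasurableSpace Ω] {μ : Measure Ω}

/-- The Markov property, tested on events of the past. -/
theorem lintegral_step [IsProbabilityMeasure μ] [IsProbabilityMeasure π]
    (hm : ∀ n, Measurable (ξ n)) (hlaw : ∀ n, μ.map (ξ n) = π)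
    (hind : ∀ n, Indep (past ξ n) (MeasurableSpace.comap (ξ (n + 1)) inferInstance) μ) (x : S) (n : ℕ) {A : Set Ω} (hA : MeasurableSet[past ξ n] A)
    (f : S → ℝ≥0∞) :
    ∫⁻ ω in A, f (drive step ξ x (n + 1) ω) ∂μ
      = ∫⁻ ω in A, transOp π step f (drive step ξ x n ω) ∂μ := by
  let _ : MeasurableSpace S := ⊤
  -- The indicator of `A` is carried along as a coordinate, so that one independence statement
  -- covers both the event and the position.
  have hX : Measurable[past ξ n] fun ω => (A.indicator (1 : Ω → ℝ≥0∞) ω, drive step ξ x n ω) :=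
    Measurable.prodMk ((@measurable_const _ _ _ (past ξ n) (1 : ℝ≥0∞)).indicator hA) (measurable_drive x n)
  have hX' := hX.mono (past_le hm n) le_rfl
  have hA' := past_le hm n _ hA
  have hXn : Measurable (drive step ξ x n) := (measurable_drive x n).mono (past_le hm n) le_rfl
  have hi : IndepFun (fun ω => (A.indicator (1 : Ω → ℝ≥0∞) ω, drive step ξ x n ω)) (ξ (n + 1)) μ := by
    exact indep_of_indep_of_le_left (hind n) hX.comap_le
  have hG : Measurable fun p : (ℝ≥0∞ × S) × α => p.1.1 * f (step p.1.2 p.2) :=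
    measurable_fst.fst.mul
      ((Measurable.of_discrete (f := fun p : S × α => f (step p.1 p.2))).comp
        (measurable_fst.snd.prodMk measurable_snd))
  have hmul : ∀ g : Ω → ℝ≥0∞, ∫⁻ ω in A, g ω ∂μ = ∫⁻ ω, A.indicator 1 ω * g ω ∂μ := by
    intro g
    rw [← lintegral_indicator hA']
    refine lintegral_congr fun ω => ?_
    by_cases h : ω ∈ A <;> simp [h]
  calc ∫⁻ ω in A, f (drive step ξ x (n + 1) ω) ∂μ
      = ∫⁻ ω, (fun p : (ℝ≥0∞ × S) × α => p.1.1 * f (step p.1.2 p.2))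
          ((A.indicator 1 ω, drive step ξ x n ω), ξ (n + 1) ω) ∂μ := hmul _
    _ = ∫⁻ ω, ∫⁻ a, A.indicator 1 ω * f (step (drive step ξ x n ω) a) ∂π ∂μ := by
        rw [← lintegral_map hG (hX'.prodMk (hm (n + 1))),
          (indepFun_iff_map_prod_eq_prod_map_map hX'.aemeasurable (hm _).aemeasurable).1 hi, hlaw,
          lintegral_prod _ hG.aemeasurable, lintegral_map hG.lintegral_prod_right' hX']
    _ = ∫⁻ ω in A, transOp π step f (drive step ξ x n ω) ∂μ := by
        rw [hmul]
        exact lintegral_congr fun ω => lintegral_const_mul _ .of_discrete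

theorem setLIntegral_avoidSet [IsProbabilityMeasure μ] [IsProbabilityMeasure π]
    (hm : ∀ n, Measurable (ξ n)) (hlaw : ∀ n, μ.map (ξ n) = π)
    (hind : ∀ n, Indep (past ξ n) (MeasurableSpace.comap (ξ (n + 1)) inferInstance) μ) (x : S) (E : Set S) (n : ℕ) (f : S → ℝ≥0∞) :
    ∫⁻ ω in avoidSet (drive step ξ x) E n, f (drive step ξ x n ω) ∂μ
      = (killOp π step E)^[n] f x := by
  induction n generalizing f with
  | zero =>
    have : avoidSet (drive step ξ x) E 0 = Set.univ := by
      ext ω; simp only [avoidSet, Set.mem_ofPred_eq, Set.mem_univ, iff_true]; omega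
    simp [this, drive]
  | succ n ih =>
    rw [Function.iterate_succ_apply, ← ih, killOp, ← lintegral_step hm hlaw hind x n
      (measurableSet_avoidSet x E n), ← lintegral_indicator, ← lintegral_indicator]
    · refine lintegral_congr fun ω => ?_
      have : ω ∈ avoidSet (drive step ξ x) E (n + 1)
          ↔ ω ∈ avoidSet (drive step ξ x) E n ∧ drive step ξ x (n + 1) ω ∉ E := by
        constructor
        · exact fun h => ⟨fun k hk hkn => h k hk (hkn.trans n.le_succ), h _ (by omega) le_rfl⟩
        · rintro ⟨h, h'⟩ k hk hkn
          rcases Nat.le_succ_iff.1 hkn with hkn | rfl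
          exacts [h k hk hkn, h']
      by_cases h1 : ω ∈ avoidSet (drive step ξ x) E n <;>
        by_cases h2 : drive step ξ x (n + 1) ω ∈ E <;> simp [this, h1, h2]
    · exact past_le hm n _ (measurableSet_avoidSet x E n)
    · exact past_le hm _ _ (measurableSet_avoidSet x E (n + 1))

theorem meanReturnTime_drive [IsProbabilityMeasure μ] [IsProbabilityMeasure π]
    (hm : ∀ n, Measurable (ξ n)) (hlaw : ∀ n, μ.map (ξ n) = π)
    (hind : ∀ n, Indep (past ξ n) (MeasurableSpace.comap (ξ (n + 1)) inferInstance) μ) (x : S) (E : Set S) :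
    meanReturnTime μ (drive step ξ) x E = meanHit π step E x := by
  rw [meanReturnTime, lintegral_congr (iInf_hit_eq_tsum (drive step ξ x) E), lintegral_tsum]
  · refine tsum_congr fun n => ?_
    rw [avoidProb, ← setLIntegral_avoidSet hm hlaw hind,
      lintegral_indicator (past_le hm n _ (measurableSet_avoidSet x E n))]
    rfl
  · exact fun n => (measurable_one.indicator
      (past_le hm n _ (measurableSet_avoidSet x E n))).aemeasurable

theorem canReach_drive_iff [IsProbabilityMeasure μ] [IsProbabilityMeasure π]
    (hm : ∀ n, Measurable (ξ n)) (hlaw : ∀ n, μ.map (ξ n) = π)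
    (hind : ∀ n, Indep (past ξ n) (MeasurableSpace.comap (ξ (n + 1)) inferInstance) μ) (x : S) (E : Set S) :
    CanReach μ (drive step ξ) x E ↔ ∃ y ∈ E, Relation.ReflTransGen (Succ π step) x y := by
  let _ : MeasurableSpace S := ⊤
  have key : ∀ n, μ {ω | drive step ξ x n ω ∈ E} = (transOp π step)^[n] (E.indicator 1) x := by
    intro n
    -- Killing at the empty set is no killing: the law of the position is a special case of the
    -- formula for avoiding paths.
    have h0 : killOp π step ∅ = transOp π step := by
      ext f s; simp [killOp]
    have h1 : avoidSet (drive step ξ x) ∅ n = Set.univ := by ext; simp [avoidSet]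
    have h2 := setLIntegral_avoidSet (π := π) (step := step) hm hlaw hind x ∅ n (E.indicator 1)
    have hXn : Measurable (drive step ξ x n) := (measurable_drive x n).mono (past_le hm n) le_rfl
    have hE : MeasurableSet {ω | drive step ξ x n ω ∈ E} := hXn trivial
    rw [h0, h1, Measure.restrict_univ] at h2
    rw [← h2, ← lintegral_indicator_one hE]
    rfl
  simp only [CanReach, key, pos_iff_ne_zero]
  constructor
  · rintro ⟨n, hn⟩
    obtain ⟨y, hy, hr⟩ := iterate_transOp_ne_zero _ _ _ hn
    exact ⟨y, by simpa using hy, hr⟩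
  · rintro ⟨y, hy, hr⟩
    exact exists_iterate_transOp_ne_zero _ hr (by simp [hy])

end Law

/-! ### Bernoulli and binomial laws -/

/-- The Bernoulli law with parameter `l`. -/
noncomputable def bern (l : ℝ) : Measure ℕ :=
  ENNReal.ofReal (1 - l) • Measure.dirac 0 + ENNReal.ofReal l • Measure.dirac 1

theorem lintegral_bern (l : ℝ) (f : ℕ → ℝ≥0∞) :
    ∫⁻ a, f a ∂bern l = ENNReal.ofReal (1 - l) * f 0 + ENNReal.ofReal l * f 1 := by
  simp [bern]

instance (l : ℝ) : IsFiniteMeasure (bern l) :=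
  ⟨by simp [bern]⟩

theorem isProbabilityMeasure_bern {l : ℝ} (h0 : 0 ≤ l) (h1 : l ≤ 1) :
    IsProbabilityMeasure (bern l) :=
  ⟨by simp [bern, ← ENNReal.ofReal_add (sub_nonneg.2 h1) h0]⟩

/-- The binomial law with parameters `n` and `l`. -/
noncomputable def bin (l : ℝ) : ℕ → Measure ℕ
  | 0 => Measure.dirac 0
  | n + 1 => ((bin l n).prod (bern l)).map fun p => p.1 + p.2

instance (l : ℝ) (n : ℕ) : IsFiniteMeasure (bin l n) := by
  induction n with
  | zero => rw [bin]; infer_instance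
  | succ n ih => rw [bin]; infer_instance

theorem isProbabilityMeasure_bin {l : ℝ} (h0 : 0 ≤ l) (h1 : l ≤ 1) (n : ℕ) :
    IsProbabilityMeasure (bin l n) := by
  induction n with
  | zero => rw [bin]; infer_instance
  | succ n ih =>
    have := isProbabilityMeasure_bern h0 h1
    rw [bin]
    exact Measure.isProbabilityMeasure_map Measurable.of_discrete.aemeasurable

theorem lintegral_bin_zero (l : ℝ) (f : ℕ → ℝ≥0∞) : ∫⁻ b, f b ∂bin l 0 = f 0 := by
  simp [bin]

theorem lintegral_bin_succ (l : ℝ) (n : ℕ) (f : ℕ → ℝ≥0∞) :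
    ∫⁻ b, f b ∂bin l (n + 1)
      = ENNReal.ofReal (1 - l) * ∫⁻ b, f b ∂bin l n
        + ENNReal.ofReal l * ∫⁻ b, f (b + 1) ∂bin l n := by
  rw [bin, lintegral_map .of_discrete .of_discrete, lintegral_prod _ Measurable.of_discrete.aemeasurable]
  simp only [lintegral_bern]
  rw [lintegral_add_left .of_discrete, lintegral_const_mul _ .of_discrete,
    lintegral_const_mul _ .of_discrete]
  rfl

theorem lintegral_bin_lt_top (l : ℝ) (n : ℕ) {f : ℕ → ℝ≥0∞} (hf : ∀ b, f b < ∞) :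
    ∫⁻ b, f b ∂bin l n < ∞ := by
  induction n generalizing f with
  | zero => rw [lintegral_bin_zero]; exact hf 0
  | succ n ih =>
    rw [lintegral_bin_succ]
    exact ENNReal.add_lt_top.2 ⟨ENNReal.mul_lt_top ENNReal.ofReal_lt_top (ih hf),
      ENNReal.mul_lt_top ENNReal.ofReal_lt_top (ih fun b => hf (b + 1))⟩

theorem lintegral_bin_cast {l : ℝ} (h0 : 0 ≤ l) (h1 : l ≤ 1) (n : ℕ) :
    ∫⁻ b, (b : ℝ≥0∞) ∂bin l n = ENNReal.ofReal (l * n) := by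
  induction n with
  | zero => simp [lintegral_bin_zero]
  | succ n ih =>
    have := isProbabilityMeasure_bin h0 h1 n
    rw [lintegral_bin_succ]
    push_cast
    rw [lintegral_add_left .of_discrete, ih, lintegral_const, measure_univ, mul_one,
      ← ENNReal.ofReal_one, ← ENNReal.ofReal_add (by positivity) zero_le_one,
      ← ENNReal.ofReal_mul (by linarith), ← ENNReal.ofReal_mul h0,
      ← ENNReal.ofReal_add (mul_nonneg (by linarith) (by positivity)) (by positivity)]
    congr 1
    ring

/-- Variance plus squared bias. The centre is arbitrary because an additional arrival shifts it in
the induction. -/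
theorem lintegral_bin_sq {l : ℝ} (h0 : 0 ≤ l) (h1 : l ≤ 1) (n : ℕ) (c : ℝ) :
    ∫⁻ b, ENNReal.ofReal (((b : ℝ) - c) ^ 2) ∂bin l n
      = ENNReal.ofReal (l * (1 - l) * n + (l * n - c) ^ 2) := by
  induction n generalizing c with
  | zero => simp [lintegral_bin_zero]
  | succ n ih =>
    have h2 : 0 ≤ 1 - l := by linarith
    have h3 : ∀ c : ℝ, 0 ≤ l * (1 - l) * n + (l * n - c) ^ 2 := fun c => by positivity
    have h4 : ∀ b : ℕ, ((b + 1 : ℕ) : ℝ) - c = b - (c - 1) := fun b => by push_cast; ring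
    rw [lintegral_bin_succ, ih]
    simp only [h4]
    rw [ih, ← ENNReal.ofReal_mul h2, ← ENNReal.ofReal_mul h0,
      ← ENNReal.ofReal_add (mul_nonneg h2 (h3 _)) (mul_nonneg h0 (h3 _))]
    congr 1
    push_cast
    ring

theorem bin_singleton_ne_zero {l : ℝ} (h0 : 0 < l) (h1 : l < 1) (n k : ℕ) (hk : k ≤ n) :
    bin l n {k} ≠ 0 := by
  rw [← lintegral_indicator_one (measurableSet_singleton k)]
  induction n generalizing k with
  | zero => simp [lintegral_bin_zero, Nat.le_zero.1 hk]
  | succ n ih =>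
    rw [lintegral_bin_succ]
    rcases Nat.le_succ_iff.1 hk with hk | rfl
    · exact fun h => (mul_ne_zero (by simpa using h1) (ih k hk)) (add_eq_zero.1 h).1
    · have : ∀ b, ({n + 1} : Set ℕ).indicator (1 : ℕ → ℝ≥0∞) (b + 1)
          = ({n} : Set ℕ).indicator 1 b := fun b => by simp [Set.indicator_apply]
      simp only [this]
      exact fun h => (mul_ne_zero (by simpa using h0) (ih n le_rfl)) (add_eq_zero.1 h).2

theorem bin_rate_zero (n : ℕ) : bin 0 n {0} ≠ 0 := by
  rw [← lintegral_indicator_one (measurableSet_singleton 0)]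
  induction n with
  | zero => simp [lintegral_bin_zero]
  | succ n ih => simpa [lintegral_bin_succ] using ih

/-- The coordinatewise image of a product of two product measures is a product measure. -/
theorem lintegral_pi_lintegral_pi {ι : Type*} [Fintype ι] (μ ν : ι → Measure ℕ)
    [∀ i, IsFiniteMeasure (μ i)] [∀ i, IsFiniteMeasure (ν i)] (φ : ι → ℕ → ℕ → ℕ)
    (F : (ι → ℕ) → ℝ≥0∞) :
    ∫⁻ b, ∫⁻ a, F (fun i => φ i (b i) (a i)) ∂Measure.pi ν ∂Measure.pi μ
      = ∫⁻ c, F c ∂Measure.pi fun i => ((μ i).prod (ν i)).map fun p => φ i p.1 p.2 := by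
  have h1 : (Measure.pi fun i => (μ i).prod (ν i)).map
      (fun f : ι → ℕ × ℕ => ((fun i => (f i).1), fun i => (f i).2))
      = (Measure.pi μ).prod (Measure.pi ν) := by
    refine Measure.ext_of_singleton fun ⟨b, a⟩ => ?_
    have h2 : (fun f : ι → ℕ × ℕ => ((fun i => (f i).1), fun i => (f i).2)) ⁻¹' {(b, a)}
        = {fun i => (b i, a i)} := by
      ext f
      simp [funext_iff, Prod.ext_iff, forall_and]
    rw [Measure.map_apply .of_discrete (measurableSet_singleton _), h2, Measure.pi_singleton,
      ← Set.singleton_prod_singleton, Measure.prod_prod, Measure.pi_singleton,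
      Measure.pi_singleton, ← Finset.prod_mul_distrib]
    refine Finset.prod_congr rfl fun i _ => ?_
    rw [← Set.singleton_prod_singleton, Measure.prod_prod]
  rw [← Measure.pi_map_pi fun i => Measurable.of_discrete.aemeasurable,
    lintegral_map .of_discrete .of_discrete,
    ← lintegral_prod (fun p : (ι → ℕ) × (ι → ℕ) => F fun i => φ i (p.1 i) (p.2 i))
      Measurable.of_discrete.aemeasurable, ← h1, lintegral_map .of_discrete .of_discrete]

/-! ### Averaging over the unobserved arrivals -/

section Avg

variable {N : ℕ}

/-- The state in which the backlogs differ from the last observed ones by `b`. -/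
def State.withGap (s : State N) (b : Fin N → ℕ) : State N :=
  { s with backlog := fun i => s.seen i + b i }

/-- The law of the arrivals to all queues at a slot boundary. -/
noncomputable abbrev arrivalLaw (lam : Fin N → ℝ) : Measure (Fin N → ℕ) :=
  Measure.pi fun i => bern (lam i)

/-- The law of the numbers of arrivals since the last observations. -/
noncomputable abbrev gapLaw (lam : Fin N → ℝ) (s : State N) : Measure (Fin N → ℕ) :=
  Measure.pi fun i => bin (lam i) (s.age i)

/-- The mean of `f` when the backlogs have their conditional law given the observations. -/
noncomputable def avg (lam : Fin N → ℝ) (f : State N → ℝ≥0∞) (s : State N) : ℝ≥0∞ :=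
  ∫⁻ b, f (s.withGap b) ∂gapLaw lam s

variable {lam : Fin N → ℝ}

theorem isProbabilityMeasure_arrivalLaw (h0 : ∀ i, 0 ≤ lam i) (h1 : ∀ i, lam i ≤ 1) :
    IsProbabilityMeasure (arrivalLaw lam) := by
  have := fun i => isProbabilityMeasure_bern (h0 i) (h1 i)
  infer_instance

theorem isProbabilityMeasure_gapLaw (h0 : ∀ i, 0 ≤ lam i) (h1 : ∀ i, lam i ≤ 1) (s : State N) :
    IsProbabilityMeasure (gapLaw lam s) := by
  have := fun i => isProbabilityMeasure_bin (h0 i) (h1 i) (s.age i)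
  infer_instance

/-- The scheduled queue is the same for all gaps. After the slot its own gap is 0, and every other
gap has gained one independent Bernoulli arrival, hence is binomial with the new age. So drawing the
gaps afresh does not change the law of the next state. -/
theorem avg_transOp (h0 : ∀ i, 0 ≤ lam i) (h1 : ∀ i, lam i ≤ 1) (K : ℕ)
    (pick : (Fin N → ℝ) → Fin N) (f : State N → ℝ≥0∞) (s : State N) :
    avg lam (transOp (arrivalLaw lam) (State.step K lam pick) f) s
      = avg lam (transOp (arrivalLaw lam) (State.step K lam pick) (avg lam f)) s := by
  classical
  set j := s.scheduled K lam pick with hj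
  let T : (Fin N → ℕ) → State N := fun c =>
    { backlog := c
      seen := fun i => if i = j then c i else s.seen i
      age := fun i => if i = j then 0 else s.age i + 1
      incumbent := j
      served := if s.Keeps K then s.served + 1 else 1 }
  -- `φ` computes the next backlog from gap and arrival. `ψ` resamples a backlog from the last
  -- observation and a fresh gap, except that of the queue just observed.
  let φ : Fin N → ℕ → ℕ → ℕ := fun i x y => (s.seen i + x - if i = j then 1 else 0) + y
  let ψ : Fin N → ℕ → ℕ → ℕ := fun i x y => if i = j then x else s.seen i + y
  let age' : Fin N → ℕ := fun i => if i = j then 0 else s.age i + 1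
  have hstep : ∀ b a, (s.withGap b).step K lam pick a = T fun i => φ i (b i) (a i) :=
    fun b a => by simp only [State.step, T]; rfl
  have hpB := fun i => isProbabilityMeasure_bern (h0 i) (h1 i)
  have hpb := fun i n => isProbabilityMeasure_bin (h0 i) (h1 i) n
  set κ : Fin N → Measure ℕ := fun i =>
    ((bin (lam i) (s.age i)).prod (bern (lam i))).map fun p => φ i p.1 p.2 with hκ
  have hpκ : ∀ i, IsProbabilityMeasure (κ i) := fun i =>
    Measure.isProbabilityMeasure_map Measurable.of_discrete.aemeasurable
  have havg : ∀ c, avg lam f (T c)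
      = ∫⁻ b, f (T fun i => ψ i (c i) (b i)) ∂Measure.pi fun i => bin (lam i) (age' i) := by
    intro c
    refine lintegral_congr_ae ?_
    have hz : ∀ᵐ b ∂Measure.pi fun i => bin (lam i) (age' i), b j = 0 := by
      refine (Measure.tendsto_eval_ae_ae (μ := fun i => bin (lam i) (age' i)) (i := j)).eventually
        (p := fun k => k = 0) ?_
      simp only [age', if_true, bin]
      simp [ae_dirac_eq]
    filter_upwards [hz] with b hb
    congr 1
    simp only [State.withGap, T, ψ, State.mk.injEq, and_true]
    constructor
    · funext i
      by_cases hi : i = j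
      · subst hi; simp [hb]
      · simp [hi]
    · funext i
      by_cases hi : i = j <;> simp [hi]
  -- Invariance of the law under resampling, coordinate by coordinate.
  have hmap : ∀ i, ((κ i).prod (bin (lam i) (age' i))).map (fun p => ψ i p.1 p.2) = κ i := by
    intro i
    by_cases hi : i = j
    · simp only [ψ, hi, if_true]
      exact (measurePreserving_fst (μ := κ j) (ν := bin (lam j) (age' j))).map_eq
    · have e1 : (fun p : ℕ × ℕ => ψ i p.1 p.2) = (fun y => s.seen i + y) ∘ Prod.snd := by
        ext p; simp [ψ, hi]
      have e2 : (fun p : ℕ × ℕ => φ i p.1 p.2) = (fun y => s.seen i + y) ∘ fun p => p.1 + p.2 := by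
        ext p; simp [φ, hi, add_assoc]
      have e3 : age' i = s.age i + 1 := by simp [age', hi]
      rw [e1, ← Measure.map_map .of_discrete .of_discrete,
        (measurePreserving_snd (μ := κ i) (ν := bin (lam i) (age' i))).map_eq, e3]
      simp only [hκ]
      rw [e2, ← Measure.map_map .of_discrete .of_discrete, bin]
  calc avg lam (transOp (arrivalLaw lam) (State.step K lam pick) f) s
      = ∫⁻ b, ∫⁻ a, f (T fun i => φ i (b i) (a i)) ∂arrivalLaw lam ∂gapLaw lam s := by
        simp only [avg, transOp, hstep]
    _ = ∫⁻ c, f (T c) ∂Measure.pi κ :=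
        lintegral_pi_lintegral_pi _ _ φ fun c => f (T c)
    _ = ∫⁻ c, avg lam f (T c) ∂Measure.pi κ := by
        simp only [havg]
        rw [lintegral_pi_lintegral_pi _ _ ψ fun c => f (T c)]
        simp only [hmap]
    _ = ∫⁻ b, ∫⁻ a, avg lam f (T fun i => φ i (b i) (a i)) ∂arrivalLaw lam ∂gapLaw lam s :=
        (lintegral_pi_lintegral_pi _ _ φ fun c => avg lam f (T c)).symm
    _ = avg lam (transOp (arrivalLaw lam) (State.step K lam pick) (avg lam f)) s := by
        simp only [avg, transOp, hstep]

theorem avg_mono {f g : State N → ℝ≥0∞} (h : ∀ s, f s ≤ g s) (s : State N) :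
    avg lam f s ≤ avg lam g s :=
  lintegral_mono fun _ => h _

theorem avg_add (f g : State N → ℝ≥0∞) (s : State N) :
    avg lam (fun t => f t + g t) s = avg lam f s + avg lam g s :=
  lintegral_add_left .of_discrete _

theorem avg_of_withGap (h0 : ∀ i, 0 ≤ lam i) (h1 : ∀ i, lam i ≤ 1) {f : State N → ℝ≥0∞}
    {s : State N} {c : ℝ≥0∞} (hf : ∀ b, f (s.withGap b) = c) :
    avg lam f s = c := by
  have := isProbabilityMeasure_gapLaw h0 h1 s
  simp [avg, hf]

theorem lintegral_gapLaw_eval (h0 : ∀ i, 0 ≤ lam i) (h1 : ∀ i, lam i ≤ 1) (s : State N)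
    (i : Fin N) (g : ℕ → ℝ≥0∞) :
    ∫⁻ b, g (b i) ∂gapLaw lam s = ∫⁻ k, g k ∂bin (lam i) (s.age i) := by
  have := fun i => isProbabilityMeasure_bin (h0 i) (h1 i) (s.age i)
  exact (measurePreserving_eval (fun i => bin (lam i) (s.age i)) i).lintegral_comp .of_discrete

theorem lintegral_arrivalLaw_eval (h0 : ∀ i, 0 ≤ lam i) (h1 : ∀ i, lam i ≤ 1)
    (i : Fin N) (g : ℕ → ℝ≥0∞) :
    ∫⁻ a, g (a i) ∂arrivalLaw lam
      = ENNReal.ofReal (1 - lam i) * g 0 + ENNReal.ofReal (lam i) * g 1 := by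
  have := fun i => isProbabilityMeasure_bern (h0 i) (h1 i)
  rw [← lintegral_bern]
  exact (measurePreserving_eval (fun i => bern (lam i)) i).lintegral_comp .of_discrete

/-- On the state space, a function with a finite average is finite. -/
theorem lt_top_of_avg_lt_top (h0 : ∀ i, 0 ≤ lam i) (h1 : ∀ i, lam i < 1) {K : ℕ}
    {f : State N → ℝ≥0∞} {s : State N} (hs : s ∈ stateSpace K lam) (h : avg lam f s < ∞) :
    f s < ∞ := by
  set b : Fin N → ℕ := fun i => s.backlog i - s.seen i with hb
  have hbs : s.withGap b = s := by
    have : (fun i => s.seen i + b i) = s.backlog := funext fun i =>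
      Nat.add_sub_cancel' (hs.2 i).1
    simp only [State.withGap, this]
  -- The constraints of the state space say exactly that the actual gap is a possible value: at most
  -- the age, and 0 at rate 0.
  have hne : gapLaw lam s {b} ≠ 0 := by
    rw [Measure.pi_singleton]
    refine Finset.prod_ne_zero_iff.2 fun i _ => ?_
    rcases (h0 i).eq_or_lt with hi | hi
    · have : b i = 0 := by simp [hb, (hs.2 i).2.2 hi.symm]
      rw [this, ← hi]
      exact bin_rate_zero _
    · exact bin_singleton_ne_zero hi (h1 i) _ _ (Nat.sub_le_iff_le_add'.2 (hs.2 i).2.1)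
  have hle : f s * gapLaw lam s {b} ≤ avg lam f s := by
    calc f s * gapLaw lam s {b} = ∫⁻ c in {b}, f (s.withGap c) ∂gapLaw lam s := by
          rw [lintegral_singleton, hbs]
      _ ≤ avg lam f s := setLIntegral_le_lintegral _ _
  by_contra htop
  rw [not_lt, top_le_iff] at htop
  rw [htop, ENNReal.top_mul hne] at hle
  exact h.not_ge hle

end Avg

/-! ### The drift of the Lyapunov function -/

section Drift

variable {N : ℕ} {K : ℕ} {lam : Fin N → ℝ} {pick : (Fin N → ℝ) → Fin N}

/-- The largest expected backlog. -/
noncomputable def State.maxIndex (lam : Fin N → ℝ) (pick : (Fin N → ℝ) → Fin N)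
    (s : State N) : ℝ :=
  s.index lam (pick (s.index lam))

/-- The amount by which the largest expected backlog exceeds the observed backlog of the
incumbent. -/
noncomputable def State.deficit (lam : Fin N → ℝ) (pick : (Fin N → ℝ) → Fin N)
    (s : State N) : ℝ :=
  max (s.maxIndex lam pick - s.seen s.incumbent) 0

open Classical in
/-- A bound for the drift caused by the rest of the current service period. -/
noncomputable def State.periodCost (K : ℕ) (lam : Fin N → ℝ) (pick : (Fin N → ℝ) → Fin N)
    (s : State N) : ℝ :=
  if s.Keeps K then 2 * ((K : ℝ) - s.served) * s.deficit lam pick else 0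

/-- The sum of the squared backlogs. -/
noncomputable def State.energy (s : State N) : ℝ≥0∞ :=
  ∑ i, (s.backlog i : ℝ≥0∞) ^ 2

/-- The Lyapunov function. -/
noncomputable def State.lyapunov (K : ℕ) (lam : Fin N → ℝ) (pick : (Fin N → ℝ) → Fin N)
    (s : State N) : ℝ≥0∞ :=
  s.energy + ENNReal.ofReal (s.periodCost K lam pick)

theorem index_nonneg (h0 : ∀ i, 0 ≤ lam i) (s : State N) (i : Fin N) : 0 ≤ s.index lam i := by
  have := h0 i
  simp only [State.index]
  positivity

theorem index_le_maxIndex (hpick : IsArgmax pick) (s : State N) (i : Fin N) :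
    s.index lam i ≤ s.maxIndex lam pick :=
  hpick _ _

theorem deficit_nonneg (s : State N) : 0 ≤ s.deficit lam pick :=
  le_max_right _ _

/-- The served backlog drops by at most 1 and every other index rises by its rate, at most 1. If the
new maximizer is the served queue, its index is what has just been observed and the deficit
vanishes. -/
theorem deficit_step_le (h1 : ∀ i, lam i ≤ 1) (hpick : IsArgmax pick)
    (s : State N) (a : Fin N → ℕ) :
    (s.step K lam pick a).deficit lam pick
      ≤ 2 + max (s.maxIndex lam pick - s.backlog (s.scheduled K lam pick)) 0 := by
  set j := s.scheduled K lam pick with hj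
  set t := s.step K lam pick a with ht
  set m := pick (t.index lam) with hm
  have hseen : t.seen t.incumbent = s.nextBacklog j a j := by
    simp [ht, State.step, ← hj]
  have hge : (s.backlog j : ℝ) - 1 ≤ s.nextBacklog j a j := by
    have : s.backlog j ≤ s.nextBacklog j a j + 1 := by
      simp only [State.nextBacklog, if_true]; omega
    have : (s.backlog j : ℝ) ≤ s.nextBacklog j a j + 1 := by exact_mod_cast this
    linarith
  have hmax := le_max_left (s.maxIndex lam pick - s.backlog j) 0
  have hmax0 := le_max_right (s.maxIndex lam pick - s.backlog j) 0
  refine max_le ?_ (by linarith)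
  rw [hseen]
  by_cases hmj : m = j
  · have : t.maxIndex lam pick = s.nextBacklog j a j := by
      rw [State.maxIndex, ← hm, hmj]
      simp [State.index, ht, State.step, ← hj]
    linarith
  · have : t.maxIndex lam pick = s.index lam m + lam m := by
      rw [State.maxIndex, ← hm]
      simp only [State.index, ht, State.step, ← hj, if_neg hmj]
      push_cast
      ring
    have := index_le_maxIndex (lam := lam) hpick s m
    have := h1 m
    linarith

theorem periodCost_nonneg (s : State N) : 0 ≤ s.periodCost K lam pick := by
  unfold State.periodCost
  split_ifs with h
  · have : (s.served : ℝ) ≤ K := by exact_mod_cast h.2.le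
    have := deficit_nonneg (lam := lam) (pick := pick) s
    exact mul_nonneg (by linarith) this
  · exact le_rfl

/-- One remaining slot fewer releases twice the deficit. The deficit grows by at most 2, which costs
at most `4 * K` over the remaining slots. -/
theorem periodCost_step_le_of_keeps (h1 : ∀ i, lam i ≤ 1) (hpick : IsArgmax pick)
    {s : State N} (hs : s.Keeps K) (hle : s.seen s.incumbent ≤ s.backlog s.incumbent)
    (a : Fin N → ℕ) :
    (s.step K lam pick a).periodCost K lam pick + 2 * s.deficit lam pick
      ≤ s.periodCost K lam pick + 4 * K := by
  have hj : s.scheduled K lam pick = s.incumbent := if_pos hs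
  have hd := deficit_step_le (K := K) h1 hpick s a
  have hd0 := deficit_nonneg (lam := lam) (pick := pick) s
  have hd1 : (s.step K lam pick a).deficit lam pick ≤ 2 + s.deficit lam pick := by
    refine hd.trans ?_
    rw [hj]
    unfold State.deficit
    have : (s.seen s.incumbent : ℝ) ≤ s.backlog s.incumbent := by exact_mod_cast hle
    gcongr
  have hserved : (s.step K lam pick a).served = s.served + 1 := if_pos hs
  have hK : (s.served : ℝ) + 1 ≤ K := by exact_mod_cast hs.2
  have hs0 : (0 : ℝ) ≤ s.served := by positivity
  rw [State.periodCost, State.periodCost, if_pos hs]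
  split_ifs
  · rw [hserved]
    push_cast
    nlinarith
  · nlinarith

theorem periodCost_step_le (h1 : ∀ i, lam i ≤ 1) (hpick : IsArgmax pick)
    (s : State N) (a : Fin N → ℕ) :
    (s.step K lam pick a).periodCost K lam pick
      ≤ 2 * K * (2 + max (s.maxIndex lam pick - s.backlog (s.scheduled K lam pick)) 0) := by
  have hd := deficit_step_le (K := K) h1 hpick s a
  have hd0 := deficit_nonneg (lam := lam) (pick := pick) (s.step K lam pick a)
  rw [State.periodCost]
  split_ifs with h
  · have : ((s.step K lam pick a).served : ℝ) ≤ K := by exact_mod_cast h.2.le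
    have : (0 : ℝ) ≤ (s.step K lam pick a).served := by positivity
    refine mul_le_mul (by linarith) hd hd0 (by positivity)
  · positivity

/-- Truncated subtraction matters only for `q = 0`, where the service term `d * q` vanishes too. The
constant 2 is generous. -/
theorem square_drift {l : ℝ} (h0 : 0 ≤ l) (h1 : l ≤ 1) (q d : ℕ) (hd : d ≤ 1) :
    ENNReal.ofReal (1 - l) * ((q - d + 0 : ℕ) : ℝ≥0∞) ^ 2
        + ENNReal.ofReal l * ((q - d + 1 : ℕ) : ℝ≥0∞) ^ 2 + 2 * (d * q : ℕ)
      ≤ (q : ℝ≥0∞) ^ 2 + (2 + 2 * (ENNReal.ofReal l * q)) := by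
  have h2 : 0 ≤ 1 - l := by linarith
  simp only [← ENNReal.ofReal_natCast, ← ENNReal.ofReal_ofNat]
  simp only [← ENNReal.ofReal_pow (Nat.cast_nonneg _)]
  rw [← ENNReal.ofReal_mul h2, ← ENNReal.ofReal_mul h0, ← ENNReal.ofReal_mul h0,
    ← ENNReal.ofReal_mul (by norm_num), ← ENNReal.ofReal_mul (by norm_num),
    ← ENNReal.ofReal_add (by positivity) (by positivity),
    ← ENNReal.ofReal_add (by positivity) (by positivity),
    ← ENNReal.ofReal_add (by norm_num) (by positivity),
    ← ENNReal.ofReal_add (by positivity) (by positivity)]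
  refine ENNReal.ofReal_le_ofReal ?_
  interval_cases d
  · push_cast
    simp
    nlinarith
  · rcases q with _ | q
    · simp; linarith
    · push_cast
      simp
      nlinarith

theorem transOp_energy_add_le (h0 : ∀ i, 0 ≤ lam i) (h1 : ∀ i, lam i ≤ 1) (s : State N) :
    transOp (arrivalLaw lam) (State.step K lam pick) State.energy s
        + 2 * (s.backlog (s.scheduled K lam pick) : ℝ≥0∞)
      ≤ s.energy + (2 * N + 2 * ∑ i, ENNReal.ofReal (lam i) * (s.backlog i : ℝ≥0∞)) := by
  classical
  set j := s.scheduled K lam pick with hj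
  have e1 : transOp (arrivalLaw lam) (State.step K lam pick) State.energy s
      = ∑ i, (ENNReal.ofReal (1 - lam i) * ((s.backlog i - (if i = j then 1 else 0) + 0 : ℕ) : ℝ≥0∞) ^ 2
        + ENNReal.ofReal (lam i) * ((s.backlog i - (if i = j then 1 else 0) + 1 : ℕ) : ℝ≥0∞) ^ 2) := by
    have : ∀ a, (s.step K lam pick a).energy
        = ∑ i, ((s.backlog i - (if i = j then 1 else 0) + a i : ℕ) : ℝ≥0∞) ^ 2 := fun a => by
      simp only [State.energy, State.step, State.nextBacklog, ← hj]
    simp only [transOp, this]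
    rw [lintegral_finsetSum _ fun i _ => .of_discrete]
    exact Finset.sum_congr rfl fun i _ => lintegral_arrivalLaw_eval h0 h1 i
      fun k => ((s.backlog i - (if i = j then 1 else 0) + k : ℕ) : ℝ≥0∞) ^ 2
  have e2 : 2 * (s.backlog j : ℝ≥0∞)
      = ∑ i, 2 * (((if i = j then 1 else 0) * s.backlog i : ℕ) : ℝ≥0∞) := by
    rw [← Finset.mul_sum]
    simp
  have e3 : (2 * N + 2 * ∑ i, ENNReal.ofReal (lam i) * (s.backlog i : ℝ≥0∞))
      = ∑ i, (2 + 2 * (ENNReal.ofReal (lam i) * (s.backlog i : ℝ≥0∞))) := by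
    rw [Finset.sum_add_distrib, ← Finset.mul_sum]
    simp [mul_comm]
  rw [e1, e2, e3, State.energy, ← Finset.sum_add_distrib, ← Finset.sum_add_distrib]
  exact Finset.sum_le_sum fun i _ => square_drift (h0 i) (h1 i) _ _ (by split_ifs <;> simp)

theorem lintegral_backlog (h0 : ∀ i, 0 ≤ lam i) (h1 : ∀ i, lam i ≤ 1) (s : State N) (i : Fin N) :
    ∫⁻ b, ((s.withGap b).backlog i : ℝ≥0∞) ∂gapLaw lam s = ENNReal.ofReal (s.index lam i) := by
  have := isProbabilityMeasure_bin (h0 i) (h1 i) (s.age i)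
  have h := lintegral_gapLaw_eval h0 h1 s i fun k => ((s.seen i + k : ℕ) : ℝ≥0∞)
  refine h.trans ?_
  push_cast
  rw [lintegral_add_left .of_discrete, lintegral_const, measure_univ, mul_one,
    lintegral_bin_cast (h0 i) (h1 i), State.index, ENNReal.ofReal_add (by positivity)
      (mul_nonneg (h0 i) (by positivity)), ENNReal.ofReal_natCast]

theorem avg_energy_lt_top (h0 : ∀ i, 0 ≤ lam i) (h1 : ∀ i, lam i ≤ 1) (s : State N) :
    avg lam State.energy s < ∞ := by
  simp only [avg, State.energy]
  rw [lintegral_finsetSum _ fun i _ => .of_discrete]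
  refine ENNReal.sum_lt_top.2 fun i _ => ?_
  have h := lintegral_gapLaw_eval h0 h1 s i fun k => ((s.seen i + k : ℕ) : ℝ≥0∞) ^ 2
  refine h.trans_lt (lintegral_bin_lt_top _ _ fun b => ?_)
  exact ENNReal.pow_lt_top (ENNReal.natCast_lt_top _)

/-- The drift bound is linear in the backlogs, so its average involves only the indices, each at
most `maxIndex`. -/
theorem avg_transOp_energy_add_le (h0 : ∀ i, 0 ≤ lam i) (h1 : ∀ i, lam i ≤ 1)
    (hpick : IsArgmax pick) (s : State N) :
    avg lam (transOp (arrivalLaw lam) (State.step K lam pick) State.energy) s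
        + ENNReal.ofReal (2 * s.index lam (s.scheduled K lam pick))
      ≤ avg lam State.energy s
        + ENNReal.ofReal (2 * N + 2 * (∑ i, lam i) * s.maxIndex lam pick) := by
  set j := s.scheduled K lam pick with hj
  have hidx := index_nonneg h0 s
  have hsum : 2 * N + 2 * ∑ i, ENNReal.ofReal (lam i) * ENNReal.ofReal (s.index lam i)
      ≤ ENNReal.ofReal (2 * N + 2 * (∑ i, lam i) * s.maxIndex lam pick) := by
    have e1 : ∑ i, ENNReal.ofReal (lam i) * ENNReal.ofReal (s.index lam i)
        = ENNReal.ofReal (∑ i, lam i * s.index lam i) := by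
      rw [ENNReal.ofReal_sum_of_nonneg fun i _ => mul_nonneg (h0 i) (hidx i)]
      exact Finset.sum_congr rfl fun i _ => (ENNReal.ofReal_mul (h0 i)).symm
    have e2 : (2 * N : ℝ≥0∞) = ENNReal.ofReal (2 * N) := by
      rw [ENNReal.ofReal_mul (by norm_num)]; simp
    have e3 : (2 : ℝ≥0∞) = ENNReal.ofReal 2 := by simp
    have h3 : ∑ i, lam i * s.index lam i ≤ (∑ i, lam i) * s.maxIndex lam pick := by
      rw [Finset.sum_mul]
      exact Finset.sum_le_sum fun i _ =>
        mul_le_mul_of_nonneg_left (index_le_maxIndex hpick s i) (h0 i)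
    rw [e1, e2, e3, ← ENNReal.ofReal_mul (by norm_num), ← ENNReal.ofReal_add (by positivity)
      (mul_nonneg (by norm_num) (Finset.sum_nonneg fun i _ => mul_nonneg (h0 i) (hidx i)))]
    exact ENNReal.ofReal_le_ofReal (by linarith)
  calc avg lam (transOp (arrivalLaw lam) (State.step K lam pick) State.energy) s
        + ENNReal.ofReal (2 * s.index lam j)
      = ∫⁻ b, (transOp (arrivalLaw lam) (State.step K lam pick) State.energy (s.withGap b)
          + 2 * ((s.withGap b).backlog j : ℝ≥0∞)) ∂gapLaw lam s := by
        rw [lintegral_add_left .of_discrete, lintegral_const_mul _ .of_discrete,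
          lintegral_backlog h0 h1, ENNReal.ofReal_mul (by norm_num), ENNReal.ofReal_ofNat]
        rfl
    _ ≤ ∫⁻ b, ((s.withGap b).energy + (2 * N + 2 * ∑ i, ENNReal.ofReal (lam i) *
          ((s.withGap b).backlog i : ℝ≥0∞))) ∂gapLaw lam s :=
        lintegral_mono fun b => transOp_energy_add_le (K := K) (pick := pick) h0 h1 (s.withGap b)
    _ = avg lam State.energy s
          + (2 * N + 2 * ∑ i, ENNReal.ofReal (lam i) * ENNReal.ofReal (s.index lam i)) := by
        have := isProbabilityMeasure_gapLaw h0 h1 s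
        rw [lintegral_add_left .of_discrete, lintegral_add_left .of_discrete, lintegral_const,
          measure_univ, mul_one, lintegral_const_mul _ .of_discrete,
          lintegral_finsetSum _ fun i _ => .of_discrete]
        congr 4
        funext i
        rw [lintegral_const_mul _ .of_discrete, lintegral_backlog h0 h1]
    _ ≤ _ := by gcongr

theorem avg_transOp_periodCost_le_of_keeps (h0 : ∀ i, 0 ≤ lam i) (h1 : ∀ i, lam i ≤ 1)
    (hpick : IsArgmax pick) {s : State N} (hs : s.Keeps K) :
    avg lam (transOp (arrivalLaw lam) (State.step K lam pick)
        fun t => ENNReal.ofReal (t.periodCost K lam pick)) s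
      ≤ ENNReal.ofReal (s.periodCost K lam pick + 4 * K - 2 * s.deficit lam pick) := by
  have := isProbabilityMeasure_gapLaw h0 h1 s
  have := isProbabilityMeasure_arrivalLaw h0 h1
  have hpt : ∀ b a, ((s.withGap b).step K lam pick a).periodCost K lam pick
      ≤ s.periodCost K lam pick + 4 * K - 2 * s.deficit lam pick := fun b a =>
    le_sub_iff_add_le.2 (periodCost_step_le_of_keeps (s := s.withGap b) h1 hpick hs
      (Nat.le_add_right _ _) a)
  refine (lintegral_mono fun b => lintegral_mono fun a =>
    ENNReal.ofReal_le_ofReal (hpt b a)).trans ?_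
  simp only [lintegral_const, measure_univ, mul_one]
  exact le_rfl

/-- The queue chosen has expected backlog `maxIndex`, so a shortfall of its true backlog is a
centred binomial fluctuation, controlled by its variance. -/
theorem avg_transOp_periodCost_le (h0 : ∀ i, 0 ≤ lam i) (h1 : ∀ i, lam i ≤ 1)
    (hpick : IsArgmax pick) {s : State N} (hs : ¬ s.Keeps K) {r : ℝ} (hr : 0 < r) :
    avg lam (transOp (arrivalLaw lam) (State.step K lam pick)
        fun t => ENNReal.ofReal (t.periodCost K lam pick)) s
      ≤ ENNReal.ofReal (4 * K + K ^ 2 / r + r * s.maxIndex lam pick) := by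
  have := isProbabilityMeasure_gapLaw h0 h1 s
  have := isProbabilityMeasure_arrivalLaw h0 h1
  set j := pick (s.index lam) with hj
  have hsch : s.scheduled K lam pick = j := if_neg hs
  have hM : s.maxIndex lam pick = s.seen j + lam j * s.age j := rfl
  have hpt : ∀ b a, ((s.withGap b).step K lam pick a).periodCost K lam pick
      ≤ (4 * K + K ^ 2 / r) + r * ((b j : ℝ) - lam j * s.age j) ^ 2 := by
    intro b a
    refine (periodCost_step_le h1 hpick (s.withGap b) a).trans ?_
    have e1 : (s.withGap b).scheduled K lam pick = j := hsch
    have e2 : (s.withGap b).maxIndex lam pick = s.maxIndex lam pick := rfl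
    have e3 : ((s.withGap b).backlog j : ℝ) = s.seen j + b j := by simp [State.withGap]
    rw [e1, e2, e3, hM]
    set x : ℝ := (b j : ℝ) - lam j * s.age j with hx
    have e4 : (s.seen j : ℝ) + lam j * s.age j - (s.seen j + b j) = -x := by rw [hx]; ring
    rw [e4]
    -- A weighted arithmetic-geometric mean inequality; the weight `r` makes the quadratic term
    -- affordable.
    have key : ∀ y : ℝ, y ^ 2 ≤ x ^ 2 → 2 * K * y ≤ K ^ 2 / r + r * x ^ 2 := by
      intro y hy
      have : 0 ≤ (K - r * y) ^ 2 / r := by positivity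
      have e : ((K : ℝ) - r * y) ^ 2 / r = K ^ 2 / r - 2 * K * y + r * y ^ 2 := by
        field_simp
        ring
      nlinarith
    rcases max_cases (-x) 0 with ⟨h, _⟩ | ⟨h, _⟩ <;> rw [h]
    · have := key (-x) (by nlinarith)
      linarith
    · have := key 0 (by nlinarith)
      linarith
  have hage : 0 ≤ lam j * s.age j := mul_nonneg (h0 j) (by positivity)
  calc avg lam (transOp (arrivalLaw lam) (State.step K lam pick)
        fun t => ENNReal.ofReal (t.periodCost K lam pick)) s
      ≤ ∫⁻ b, (ENNReal.ofReal (4 * K + K ^ 2 / r)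
          + ENNReal.ofReal r * ENNReal.ofReal (((b j : ℝ) - lam j * s.age j) ^ 2)) ∂gapLaw lam s := by
        refine lintegral_mono fun b => ?_
        refine (lintegral_mono fun a => ENNReal.ofReal_le_ofReal (hpt b a)).trans ?_
        rw [lintegral_const, measure_univ, mul_one, ENNReal.ofReal_add (by positivity)
          (by positivity), ENNReal.ofReal_mul hr.le]
    _ = ENNReal.ofReal (4 * K + K ^ 2 / r)
          + ENNReal.ofReal (r * (lam j * (1 - lam j) * s.age j)) := by
        have h := lintegral_gapLaw_eval h0 h1 s j
          fun k => ENNReal.ofReal (((k : ℝ) - lam j * s.age j) ^ 2)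
        rw [lintegral_add_left .of_discrete, lintegral_const, measure_univ, mul_one,
          lintegral_const_mul _ .of_discrete, h, lintegral_bin_sq (h0 j) (h1 j),
          ENNReal.ofReal_mul hr.le]
        simp
    _ ≤ _ := by
        have h2 : 0 ≤ 1 - lam j := by linarith [h1 j]
        -- The decisive comparison: the variance is at most the mean number of unobserved arrivals,
        -- which is part of the index.
        have h3 : lam j * (1 - lam j) * s.age j ≤ s.maxIndex lam pick := by
          rw [hM]
          have : 0 ≤ lam j * (lam j * s.age j) := mul_nonneg (h0 j) hage
          have : (0 : ℝ) ≤ s.seen j := by positivity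
          linarith
        rw [← ENNReal.ofReal_add (by positivity)
          (mul_nonneg hr.le (mul_nonneg (mul_nonneg (h0 j) h2) (by positivity)))]
        refine ENNReal.ofReal_le_ofReal ?_
        have := mul_le_mul_of_nonneg_left h3 hr.le
        linarith

theorem avg_lyapunov (h0 : ∀ i, 0 ≤ lam i) (h1 : ∀ i, lam i ≤ 1) (s : State N) :
    avg lam (State.lyapunov K lam pick) s
      = avg lam State.energy s + ENNReal.ofReal (s.periodCost K lam pick) := by
  have h := avg_add (lam := lam) State.energy
    (fun t => ENNReal.ofReal (t.periodCost K lam pick)) s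
  exact h.trans (congrArg _ (avg_of_withGap h0 h1 fun b => rfl))

/-- A bound for the largest expected backlog above which the drift is at most `-1`. -/
noncomputable def driftLevel (N K : ℕ) (lam : Fin N → ℝ) : ℝ :=
  (2 * N + 4 * K + K ^ 2 / (1 - ∑ i, lam i) + 1) / (1 - ∑ i, lam i)

/-- If the incumbent keeps the server, its index is at least `maxIndex - deficit`, and the released
prepayment covers the loss. Otherwise the scheduled index is `maxIndex`, and the new prepayment uses
up half of the linear drift. The reals `x` and `y` allow a negative drift to be stated without
truncated subtraction. -/
theorem avg_transOp_lyapunov_le (h0 : ∀ i, 0 ≤ lam i) (hsum : ∑ i, lam i < 1)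
    (h1 : ∀ i, lam i ≤ 1) (hpick : IsArgmax pick) (s : State N) :
    ∃ x y : ℝ, avg lam (State.lyapunov K lam pick) s = ENNReal.ofReal x ∧
      avg lam (transOp (arrivalLaw lam) (State.step K lam pick) (State.lyapunov K lam pick)) s
        ≤ ENNReal.ofReal y ∧
      0 ≤ y ∧ y + (1 - ∑ i, lam i) * (s.maxIndex lam pick - driftLevel N K lam) + 1 ≤ x := by
  have hr : 0 < 1 - ∑ i, lam i := by linarith
  set r := 1 - ∑ i, lam i with hrdef
  have hlevel : r * driftLevel N K lam = 2 * N + 4 * K + K ^ 2 / r + 1 := by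
    rw [driftLevel, ← hrdef]; field_simp
  have hM0 : 0 ≤ s.maxIndex lam pick := index_nonneg h0 s _
  have hen := avg_transOp_energy_add_le (K := K) h0 h1 hpick s
  obtain ⟨ℓ, hℓ0, hℓ⟩ : ∃ ℓ : ℝ, 0 ≤ ℓ ∧ avg lam State.energy s = ENNReal.ofReal ℓ :=
    ⟨_, ENNReal.toReal_nonneg, (ENNReal.ofReal_toReal (avg_energy_lt_top h0 h1 s).ne).symm⟩
  have hR0 : 0 ≤ 2 * N + 2 * (∑ i, lam i) * s.maxIndex lam pick := by
    have := Finset.sum_nonneg fun i (_ : i ∈ Finset.univ) => h0 i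
    positivity
  have hJ0 := index_nonneg h0 s (s.scheduled K lam pick)
  rw [hℓ, ← ENNReal.ofReal_add hℓ0 hR0] at hen
  obtain ⟨p, hp0, hp⟩ : ∃ p : ℝ, 0 ≤ p ∧
      avg lam (transOp (arrivalLaw lam) (State.step K lam pick) State.energy) s
        = ENNReal.ofReal p :=
    ⟨_, ENNReal.toReal_nonneg, (ENNReal.ofReal_toReal
      (ne_top_of_le_ne_top ENNReal.ofReal_ne_top (le_self_add.trans hen))).symm⟩
  rw [hp, ← ENNReal.ofReal_add hp0 (by linarith),
    ENNReal.ofReal_le_ofReal_iff (by linarith)] at hen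
  have hsplit : avg lam (transOp (arrivalLaw lam) (State.step K lam pick)
        (State.lyapunov K lam pick)) s
      = ENNReal.ofReal p + avg lam (transOp (arrivalLaw lam) (State.step K lam pick)
        fun t => ENNReal.ofReal (t.periodCost K lam pick)) s := by
    rw [← hp, ← avg_add]
    exact congrArg (fun f => avg lam f s) (funext fun t => transOp_add _ _ _)
  have hc0 := periodCost_nonneg (K := K) (lam := lam) (pick := pick) s
  rw [hsplit, avg_lyapunov h0 h1, hℓ, ← ENNReal.ofReal_add hℓ0 hc0]
  have hsl : ∑ i, lam i = 1 - r := by rw [hrdef]; ring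
  rw [hsl] at hen
  by_cases hs : s.Keeps K
  · have hb : 0 ≤ s.periodCost K lam pick + 4 * K - 2 * s.deficit lam pick := by
      have hK : (s.served : ℝ) + 1 ≤ K := by exact_mod_cast hs.2
      have := deficit_nonneg (lam := lam) (pick := pick) s
      rw [State.periodCost, if_pos hs]
      nlinarith
    refine ⟨_, _, rfl, ?_, add_nonneg hp0 hb, ?_⟩
    · rw [ENNReal.ofReal_add hp0 hb]
      gcongr
      exact avg_transOp_periodCost_le_of_keeps h0 h1 hpick hs
    · have hj : s.scheduled K lam pick = s.incumbent := if_pos hs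
      rw [hj] at hen
      have hd : s.maxIndex lam pick - s.seen s.incumbent ≤ s.deficit lam pick := le_max_left _ _
      have hidx : (s.seen s.incumbent : ℝ) ≤ s.index lam s.incumbent :=
        le_add_of_nonneg_right (mul_nonneg (h0 _) (by positivity))
      have : 0 ≤ (K : ℝ) ^ 2 / r := by positivity
      have := mul_nonneg hr.le hM0
      rw [mul_sub, hlevel]
      linarith
  · have hb : 0 ≤ 4 * K + (K : ℝ) ^ 2 / r + r * s.maxIndex lam pick := by positivity
    refine ⟨_, _, rfl, ?_, add_nonneg hp0 hb, ?_⟩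
    · rw [ENNReal.ofReal_add hp0 hb]
      gcongr
      exact avg_transOp_periodCost_le h0 h1 hpick hs hr
    · have hj : s.index lam (s.scheduled K lam pick) = s.maxIndex lam pick := by
        rw [State.scheduled, if_neg hs, State.maxIndex]
      rw [hj] at hen
      rw [mul_sub, hlevel]
      linarith

/-- Foster's argument for averages. Taking one step before evaluating the Lyapunov function gives a
bound valid also inside the level set, where no negative drift is available. -/
theorem avg_truncHit_le (h0 : ∀ i, 0 ≤ lam i) (hsum : ∑ i, lam i < 1)
    (h1 : ∀ i, lam i ≤ 1) (hpick : IsArgmax pick) (k : ℕ) (s : State N) :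
    avg lam (truncHit (arrivalLaw lam) (State.step K lam pick)
        {t | t.maxIndex lam pick ≤ driftLevel N K lam} k) s
      ≤ 1 + avg lam (transOp (arrivalLaw lam) (State.step K lam pick)
        (State.lyapunov K lam pick)) s := by
  set E : Set (State N) := {t | t.maxIndex lam pick ≤ driftLevel N K lam} with hE
  induction k generalizing s with
  | zero => simp [truncHit, avg]
  | succ k ih =>
    have hout : ∀ t, avg lam (Eᶜ.indicator (truncHit (arrivalLaw lam) (State.step K lam pick) E k)) t
        ≤ avg lam (State.lyapunov K lam pick) t := by
      intro t
      -- The level set depends only on observed quantities, so killing on it is compatible with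
      -- averaging over the gaps.
      have hinv : ∀ b, t.withGap b ∈ E ↔ t ∈ E := fun b => Iff.rfl
      by_cases ht : t ∈ E
      · rw [avg_of_withGap h0 h1 fun b => Set.indicator_of_notMem (by simpa [hinv] using ht) _]
        exact zero_le
      · refine (avg_mono (Set.indicator_le_self _ _) t).trans ((ih t).trans ?_)
        obtain ⟨x, y, hx, hy, hy0, hxy⟩ := avg_transOp_lyapunov_le (K := K) h0 hsum h1 hpick t
        rw [hx]
        calc 1 + avg lam (transOp (arrivalLaw lam) (State.step K lam pick)
              (State.lyapunov K lam pick)) t ≤ ENNReal.ofReal 1 + ENNReal.ofReal y := by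
              rw [ENNReal.ofReal_one]; gcongr
          _ = ENNReal.ofReal (1 + y) := (ENNReal.ofReal_add zero_le_one hy0).symm
          _ ≤ ENNReal.ofReal x := by
              refine ENNReal.ofReal_le_ofReal ?_
              have hlt : driftLevel N K lam < t.maxIndex lam pick := not_le.1 ht
              have := mul_pos (sub_pos.2 hsum) (sub_pos.2 hlt)
              linarith
    have hsucc : truncHit (arrivalLaw lam) (State.step K lam pick) E (k + 1)
        = fun t => 1 + killOp (arrivalLaw lam) (State.step K lam pick) E
          (truncHit (arrivalLaw lam) (State.step K lam pick) E k) t :=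
      funext fun t => truncHit_succ k t
    rw [hsucc, avg_add, avg_of_withGap (c := 1) h0 h1 fun b => rfl]
    gcongr
    calc avg lam (killOp (arrivalLaw lam) (State.step K lam pick) E
          (truncHit (arrivalLaw lam) (State.step K lam pick) E k)) s
        = avg lam (transOp (arrivalLaw lam) (State.step K lam pick) (avg lam
          (Eᶜ.indicator (truncHit (arrivalLaw lam) (State.step K lam pick) E k)))) s :=
          avg_transOp h0 h1 K pick _ s
      _ ≤ avg lam (transOp (arrivalLaw lam) (State.step K lam pick) (avg lam
          (State.lyapunov K lam pick))) s :=
          avg_mono (fun t => transOp_mono hout t) s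
      _ = _ := (avg_transOp h0 h1 K pick _ s).symm

/-- From every state of the state space, the mean time until all expected backlogs are below a
fixed level is finite. -/
theorem meanHit_maxIndex_lt_top (h0 : ∀ i, 0 ≤ lam i) (hsum : ∑ i, lam i < 1)
    (h1 : ∀ i, lam i < 1) (hpick : IsArgmax pick) {s : State N} (hs : s ∈ stateSpace K lam) :
    meanHit (arrivalLaw lam) (State.step K lam pick)
      {t | t.maxIndex lam pick ≤ driftLevel N K lam} s < ∞ := by
  have h1' := fun i => (h1 i).le
  refine lt_top_of_avg_lt_top h0 h1 hs ?_
  have hsup : meanHit (arrivalLaw lam) (State.step K lam pick)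
      {t | t.maxIndex lam pick ≤ driftLevel N K lam}
      = fun t => ⨆ k, truncHit (arrivalLaw lam) (State.step K lam pick)
        {t | t.maxIndex lam pick ≤ driftLevel N K lam} k t :=
    funext fun t => ENNReal.tsum_eq_iSup_nat
  rw [hsup, avg, lintegral_iSup (f := fun k b => truncHit (arrivalLaw lam) (State.step K lam pick)
    {t | t.maxIndex lam pick ≤ driftLevel N K lam} k (s.withGap b)) (fun k => .of_discrete)
    fun j k hjk b => truncHit_mono hjk _]
  obtain ⟨x, y, -, hy, -⟩ := avg_transOp_lyapunov_le (K := K) h0 hsum h1' hpick s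
  refine (iSup_le fun k => avg_truncHit_le h0 hsum h1' hpick k s).trans_lt ?_
  exact ENNReal.add_lt_top.2 ⟨ENNReal.one_lt_top, hy.trans_lt ENNReal.ofReal_lt_top⟩

end Drift

/-! ### Accessibility of the empty system -/

section Reach

variable {N : ℕ} {K : ℕ} {lam : Fin N → ℝ} {pick : (Fin N → ℝ) → Fin N}

theorem arrivalLaw_singleton_ne_zero {a : Fin N → ℕ} (h : arrivalLaw lam {a} ≠ 0) (i : Fin N) :
    a i ≤ 1 ∧ (lam i = 0 → a i = 0) := by
  rw [Measure.pi_singleton, Finset.prod_ne_zero_iff] at h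
  have hi := h i (Finset.mem_univ i)
  rw [← lintegral_indicator_one (measurableSet_singleton _), lintegral_bern] at hi
  refine ⟨?_, fun hl => ?_⟩
  · by_contra! hlt
    refine hi ?_
    simp [show (0 : ℕ) ≠ a i by omega, show (1 : ℕ) ≠ a i by omega]
  · by_contra hne
    refine hi ?_
    simp [Set.indicator_apply, hl, Ne.symm hne]

theorem arrivalLaw_zero_ne_zero (h1 : ∀ i, lam i < 1) : arrivalLaw lam {0} ≠ 0 := by
  rw [Measure.pi_singleton, Finset.prod_ne_zero_iff]
  intro i _
  rw [← lintegral_indicator_one (measurableSet_singleton _), lintegral_bern]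
  simp [h1 i]

theorem succ_step_zero (h1 : ∀ i, lam i < 1) (s : State N) :
    Succ (arrivalLaw lam) (State.step K lam pick) s (s.step K lam pick 0) :=
  ⟨0, arrivalLaw_zero_ne_zero h1, rfl⟩

theorem mem_stateSpace_of_succ (hK : 1 ≤ K) {s t : State N} (hs : s ∈ stateSpace K lam)
    (h : Succ (arrivalLaw lam) (State.step K lam pick) s t) : t ∈ stateSpace K lam := by
  obtain ⟨a, ha, rfl⟩ := h
  have ha' := arrivalLaw_singleton_ne_zero ha
  refine ⟨?_, fun i => ?_⟩
  · simp only [State.step]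
    split_ifs with hk
    exacts [hk.2, hK]
  · obtain ⟨h1, h2, h3⟩ := hs.2 i
    obtain ⟨ha1, ha2⟩ := ha' i
    simp only [State.step, State.nextBacklog]
    by_cases hi : i = s.scheduled K lam pick
    · simp [hi]
    · simp only [hi, if_false]
      refine ⟨by omega, by omega, fun hl => ?_⟩
      have := h3 hl
      have := ha2 hl
      omega

theorem mem_stateSpace_of_reflTransGen (hK : 1 ≤ K) {s t : State N} (hs : s ∈ stateSpace K lam)
    (h : Relation.ReflTransGen (Succ (arrivalLaw lam) (State.step K lam pick)) s t) :
    t ∈ stateSpace K lam := by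
  induction h with
  | refl => exact hs
  | tail _ h ih => exact mem_stateSpace_of_succ hK ih h

/-- The contribution of queue `i` to a potential that decreases as long as nothing arrives.
A queue with unobserved packets contributes the time that its expected backlog may still
need to reach `1`. -/
noncomputable def State.potentialAt (lam : Fin N → ℝ) (T : ℕ) (s : State N) (i : Fin N) : ℝ :=
  s.backlog i + lam i * s.age i + if s.seen i < s.backlog i then 2 * ((T - s.age i : ℕ) : ℝ) else 0

theorem potentialAt_nonneg (h0 : ∀ i, 0 ≤ lam i) (T : ℕ) (s : State N) (i : Fin N) :
    0 ≤ s.potentialAt lam T i := by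
  have := h0 i
  unfold State.potentialAt
  split_ifs <;> positivity

theorem potentialAt_step_scheduled (T : ℕ) (s : State N) :
    (s.step K lam pick 0).potentialAt lam T (s.scheduled K lam pick)
      = (s.backlog (s.scheduled K lam pick) - 1 : ℕ) := by
  simp [State.potentialAt, State.step, State.nextBacklog]

theorem potentialAt_step_of_ne (T : ℕ) (s : State N) {i : Fin N}
    (hi : i ≠ s.scheduled K lam pick) :
    (s.step K lam pick 0).potentialAt lam T i
      = s.backlog i + lam i * (s.age i + 1)
        + if s.seen i < s.backlog i then 2 * ((T - (s.age i + 1) : ℕ) : ℝ) else 0 := by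
  simp [State.potentialAt, State.step, State.nextBacklog, hi]

theorem potentialAt_step_le (h0 : ∀ i, 0 ≤ lam i) (T : ℕ) (s : State N) (i : Fin N) :
    (s.step K lam pick 0).potentialAt lam T i ≤ s.potentialAt lam T i + lam i := by
  by_cases hi : i = s.scheduled K lam pick
  · have h1 : ((s.backlog i - 1 : ℕ) : ℝ) ≤ s.backlog i := by exact_mod_cast Nat.sub_le _ _
    have h2 : 0 ≤ lam i * s.age i := mul_nonneg (h0 i) (by positivity)
    have h3 := h0 i
    have h4 := potentialAt_step_scheduled (K := K) (lam := lam) (pick := pick) T s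
    rw [← hi] at h4
    rw [h4, State.potentialAt]
    have h5 : (0 : ℝ) ≤ if s.seen i < s.backlog i then 2 * ((T - s.age i : ℕ) : ℝ) else 0 := by
      split_ifs <;> positivity
    linarith
  · rw [potentialAt_step_of_ne T s hi, State.potentialAt]
    have h1 : ((T - (s.age i + 1) : ℕ) : ℝ) ≤ (T - s.age i : ℕ) := by
      exact_mod_cast (by omega : T - (s.age i + 1) ≤ T - s.age i)
    split_ifs <;> linarith

/-- A nonempty scheduled queue loses a packet. An empty one with `lam j * age j ≥ 1` loses that
amount when its age is reset. In the remaining case it was chosen by its index, so all indices are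
below 1. A nonempty queue then has last observation 0 and age below `T`, and its countdown `T - age`
advances. -/
theorem exists_potentialAt_step_le (h0 : ∀ i, 0 ≤ lam i) (hpick : IsArgmax pick) {T : ℕ}
    (hT : ∀ i, lam i ≠ 0 → 1 ≤ lam i * T) {s : State N} (hs : s ∈ stateSpace K lam)
    (hne : s.backlog ≠ 0) :
    ∃ i, (s.step K lam pick 0).potentialAt lam T i ≤ s.potentialAt lam T i + lam i - 1 := by
  set j := s.scheduled K lam pick with hj
  have hjpot := potentialAt_step_scheduled (K := K) (lam := lam) (pick := pick) T s
  rw [← hj] at hjpot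
  have hjage : 0 ≤ lam j * s.age j := mul_nonneg (h0 j) (by positivity)
  have hjl := h0 j
  have hjgap : (0 : ℝ) ≤ if s.seen j < s.backlog j then 2 * ((T - s.age j : ℕ) : ℝ) else 0 := by
    split_ifs <;> positivity
  by_cases hbj : 1 ≤ s.backlog j
  · refine ⟨j, ?_⟩
    rw [hjpot, State.potentialAt, Nat.cast_sub hbj]
    push_cast
    linarith
  have hbj0 : s.backlog j = 0 := by omega
  have hsj0 : s.seen j = 0 := by have := (hs.2 j).1; omega
  by_cases hage : 1 ≤ lam j * s.age j
  · refine ⟨j, ?_⟩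
    rw [hjpot, State.potentialAt, hbj0]
    push_cast
    norm_num
    linarith
  obtain ⟨m, hm⟩ := Function.ne_iff.1 hne
  have hkeep : ¬ s.Keeps K := by
    intro hk
    have hji : j = s.incumbent := if_pos hk
    have := hk.1
    rw [← hji] at this
    omega
  have hjp : j = pick (s.index lam) := if_neg hkeep
  have hidx : s.index lam m ≤ s.index lam j := hjp ▸ hpick (s.index lam) m
  have hidx' : (s.seen m : ℝ) + lam m * s.age m < 1 := by
    refine hidx.trans_lt ?_
    rw [State.index, hsj0]
    push_cast
    linarith
  have hmage : 0 ≤ lam m * s.age m := mul_nonneg (h0 m) (by positivity)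
  have hsm : s.seen m = 0 := by
    have : (s.seen m : ℝ) < 1 := by linarith
    have : s.seen m < 1 := by exact_mod_cast this
    omega
  have hbm : s.backlog m ≠ 0 := hm
  have hgap : s.seen m < s.backlog m := by omega
  have hlm : lam m ≠ 0 := fun h => by have := (hs.2 m).2.2 h; omega
  have hlm' : 0 < lam m := lt_of_le_of_ne (h0 m) hlm.symm
  have hageT : s.age m < T := by
    have h1 := hT m hlm
    have h2 : (0 : ℝ) ≤ s.seen m := by positivity
    have : (s.age m : ℝ) < T := lt_of_mul_lt_mul_left (by linarith) hlm'.le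
    exact_mod_cast this
  have hmj : m ≠ j := fun h => hbm (h ▸ hbj0)
  refine ⟨m, ?_⟩
  rw [potentialAt_step_of_ne T s hmj, State.potentialAt, if_pos hgap, if_pos hgap]
  have : ((T - s.age m : ℕ) : ℝ) = (T - (s.age m + 1) : ℕ) + 1 := by
    exact_mod_cast (by omega : T - s.age m = T - (s.age m + 1) + 1)
  rw [this]
  linarith

theorem sum_potentialAt_step_le (h0 : ∀ i, 0 ≤ lam i) (hpick : IsArgmax pick) {T : ℕ}
    (hT : ∀ i, lam i ≠ 0 → 1 ≤ lam i * T) {s : State N} (hs : s ∈ stateSpace K lam)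
    (hne : s.backlog ≠ 0) :
    ∑ i, (s.step K lam pick 0).potentialAt lam T i
      ≤ ∑ i, s.potentialAt lam T i - (1 - ∑ i, lam i) := by
  classical
  obtain ⟨m, hm⟩ := exists_potentialAt_step_le (pick := pick) h0 hpick hT hs hne
  have h : ∑ i, (s.step K lam pick 0).potentialAt lam T i
      ≤ ∑ i, (s.potentialAt lam T i + lam i - if i = m then 1 else 0) := by
    refine Finset.sum_le_sum fun i _ => ?_
    by_cases hi : i = m
    · subst hi; simpa using hm
    · simpa [hi] using potentialAt_step_le h0 T s i
  rw [Finset.sum_sub_distrib, Finset.sum_add_distrib] at h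
  simp only [Finset.sum_ite_eq', Finset.mem_univ, if_true] at h
  linarith

/-- The empty system is accessible from every state. -/
theorem exists_reach_empty (hK : 1 ≤ K) (h0 : ∀ i, 0 ≤ lam i) (hsum : ∑ i, lam i < 1)
    (h1 : ∀ i, lam i < 1) (hpick : IsArgmax pick) {s : State N} (hs : s ∈ stateSpace K lam) :
    ∃ t : State N, t.backlog = 0 ∧
      Relation.ReflTransGen (Succ (arrivalLaw lam) (State.step K lam pick)) s t := by
  obtain ⟨T, hT⟩ : ∃ T : ℕ, ∀ i, lam i ≠ 0 → 1 ≤ lam i * T := by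
    refine ⟨∑ i, ⌈(lam i)⁻¹⌉₊, fun i hi => ?_⟩
    have hi' : 0 < lam i := lt_of_le_of_ne (h0 i) hi.symm
    have h2 : (⌈(lam i)⁻¹⌉₊ : ℝ) ≤ (∑ i, ⌈(lam i)⁻¹⌉₊ : ℕ) := by
      exact_mod_cast Finset.single_le_sum (f := fun i => ⌈(lam i)⁻¹⌉₊) (fun _ _ => Nat.zero_le _)
        (Finset.mem_univ i)
    calc 1 = lam i * (lam i)⁻¹ := (mul_inv_cancel₀ hi).symm
      _ ≤ _ := mul_le_mul_of_nonneg_left ((Nat.le_ceil _).trans h2) hi'.le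
  -- Each slot without arrivals from a nonempty system costs at least `1 - ∑ λ_i` of a nonnegative
  -- potential; the induction counts how many such slots are affordable.
  have key : ∀ n : ℕ, ∀ s ∈ stateSpace K lam,
      ∑ i, s.potentialAt lam T i < n * (1 - ∑ i, lam i) → ∃ t : State N, t.backlog = 0 ∧
        Relation.ReflTransGen (Succ (arrivalLaw lam) (State.step K lam pick)) s t := by
    intro n
    induction n with
    | zero =>
      intro s _ h
      have := Finset.sum_nonneg fun i (_ : i ∈ Finset.univ) => potentialAt_nonneg h0 T s i
      simp only [Nat.cast_zero, zero_mul] at h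
      linarith
    | succ n ih =>
      intro s hs h
      by_cases hne : s.backlog = 0
      · exact ⟨s, hne, .refl⟩
      have hsucc := succ_step_zero (K := K) (pick := pick) h1 s
      obtain ⟨t, ht, hr⟩ := ih _ (mem_stateSpace_of_succ hK hs hsucc) (by
        have := sum_potentialAt_step_le (pick := pick) h0 hpick hT hs hne
        push_cast at h
        linarith)
      exact ⟨t, ht, .head hsucc hr⟩
  obtain ⟨n, hn⟩ := exists_nat_gt ((∑ i, s.potentialAt lam T i) / (1 - ∑ i, lam i))
  exact key n s hs ((div_lt_iff₀ (by linarith)).1 hn)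

end Reach

/-! ### The state without the ages of the queues that never receive an arrival -/

section EssentialPart

variable {N : ℕ} {K : ℕ} {lam : Fin N → ℝ} {pick : (Fin N → ℝ) → Fin N}

theorem essentialPart_eq_iff {s t : State N} :
    s.essentialPart lam = t.essentialPart lam ↔ s.backlog = t.backlog ∧ s.seen = t.seen ∧
      (∀ i, lam i ≠ 0 → s.age i = t.age i) ∧ s.incumbent = t.incumbent ∧ s.served = t.served := by
  simp only [State.essentialPart, State.mk.injEq, funext_iff]
  refine and_congr Iff.rfl (and_congr Iff.rfl (and_congr (forall_congr' fun i => ?_) Iff.rfl))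
  by_cases hi : lam i = 0 <;> simp [hi]

theorem index_congr {s t : State N} (h : s.essentialPart lam = t.essentialPart lam) :
    s.index lam = t.index lam := by
  obtain ⟨-, h2, h3, -, -⟩ := essentialPart_eq_iff.1 h
  funext i
  by_cases hi : lam i = 0
  · simp [State.index, hi, h2]
  · simp [State.index, h2, h3 i hi]

theorem essentialPart_step {s t : State N} (h : s.essentialPart lam = t.essentialPart lam)
    (a : Fin N → ℕ) :
    (s.step K lam pick a).essentialPart lam = (t.step K lam pick a).essentialPart lam := by
  classical
  obtain ⟨h1, h2, h3, h4, h5⟩ := essentialPart_eq_iff.1 h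
  have hk : s.Keeps K ↔ t.Keeps K := by simp only [State.Keeps, h2, h4, h5]
  have hj : s.scheduled K lam pick = t.scheduled K lam pick := by
    rw [State.scheduled, State.scheduled, h4, index_congr h]
    exact if_congr hk rfl rfl
  have hb : s.nextBacklog = t.nextBacklog := by
    funext j a i
    simp only [State.nextBacklog, h1]
  refine essentialPart_eq_iff.2 ?_
  simp only [State.step, hb, hj, h2, h5, true_and]
  exact ⟨fun i hi => by rw [h3 i hi], if_congr hk rfl rfl⟩

theorem finite_essentialPart (h0 : ∀ i, 0 ≤ lam i) (hpick : IsArgmax pick) (B : ℝ) :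
    (State.essentialPart lam '' (stateSpace K lam ∩ {s | s.maxIndex lam pick ≤ B})).Finite := by
  -- `T` bounds every last observation and every age with nonzero rate, so `2 * T` bounds the
  -- backlogs. Queues with rate 0 add 0, since division by 0 gives 0.
  set T : ℕ := ⌈B⌉₊ + ∑ i, ⌈B / lam i⌉₊ with hT
  set M : Fin N → ℕ := fun _ => 2 * T with hM
  let ψ : State N → (Fin N → ℕ) × (Fin N → ℕ) × (Fin N → ℕ) × Fin N × ℕ := fun s =>
    (s.backlog, s.seen, s.age, s.incumbent, s.served)
  have hψ : Function.Injective ψ := by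
    rintro ⟨⟩ ⟨⟩ h
    simpa [ψ] using h
  refine Set.Finite.subset (((Set.finite_Icc 0 M).prod ((Set.finite_Icc 0 M).prod
    ((Set.finite_Icc 0 M).prod (Set.finite_univ.prod (Set.finite_Iic K))))).preimage
    (f := ψ) hψ.injOn) ?_
  rintro _ ⟨s, ⟨hs, hB⟩, rfl⟩
  have hidx : ∀ i, (s.seen i : ℝ) + lam i * s.age i ≤ B := fun i =>
    (index_le_maxIndex hpick s i).trans hB
  have hseen : ∀ i, s.seen i ≤ T := fun i => by
    have h1 : 0 ≤ lam i * s.age i := mul_nonneg (h0 i) (by positivity)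
    have h2 : (s.seen i : ℝ) ≤ ⌈B⌉₊ := le_trans (by linarith [hidx i]) (Nat.le_ceil B)
    have h3 : s.seen i ≤ ⌈B⌉₊ := by exact_mod_cast h2
    omega
  have hage : ∀ i, lam i ≠ 0 → s.age i ≤ T := fun i hi => by
    have hi' : 0 < lam i := lt_of_le_of_ne (h0 i) hi.symm
    have h1 : (0 : ℝ) ≤ s.seen i := by positivity
    have h2 : (s.age i : ℝ) ≤ B / lam i := by
      rw [le_div_iff₀ hi']
      linarith [hidx i]
    have h3 : s.age i ≤ ⌈B / lam i⌉₊ := by exact_mod_cast h2.trans (Nat.le_ceil _)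
    have h4 : ⌈B / lam i⌉₊ ≤ ∑ i, ⌈B / lam i⌉₊ :=
      Finset.single_le_sum (f := fun i => ⌈B / lam i⌉₊) (fun _ _ => Nat.zero_le _)
        (Finset.mem_univ i)
    omega
  have hback : ∀ i, s.backlog i ≤ 2 * T := fun i => by
    obtain ⟨_, h2, h3⟩ := hs.2 i
    have := hseen i
    by_cases hi : lam i = 0
    · have := h3 hi
      omega
    · have := hage i hi
      omega
  simp only [Set.mem_preimage, Set.mem_prod, Set.mem_Icc, Set.mem_univ, Set.mem_Iic, true_and, ψ,
    State.essentialPart, zero_le]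
  refine ⟨hback, fun i => ?_, fun i => ?_, hs.1⟩
  · have := hseen i
    simp only [hM]
    omega
  · simp only [hM]
    split_ifs with hi
    · omega
    · have := hage i hi
      omega

end EssentialPart

/-! ### Essential states -/

section Essential

variable {S α β : Type*} [MeasurableSpace α] {π : Measure α} {step : S → α → S} {C R : Set S}
  {e : S → β}

theorem exists_reflTransGen_of_eq (he : ∀ s t, e s = e t → ∀ a, e (step s a) = e (step t a))
    {s t u : S} (hst : e s = e t) (h : Relation.ReflTransGen (Succ π step) s u) :
    ∃ v, e u = e v ∧ Relation.ReflTransGen (Succ π step) t v := by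
  induction h with
  | refl => exact ⟨t, hst, .refl⟩
  | tail _ h ih =>
    obtain ⟨v, hv, hr⟩ := ih
    obtain ⟨a, ha, rfl⟩ := h
    exact ⟨step v a, he _ _ hv a, hr.tail ⟨a, ha, rfl⟩⟩

/-- If a set that is finite up to equivalence is accessible from everywhere, then a state to whose
class the chain can always return is accessible from everywhere. -/
theorem exists_reach_essential
    (hR : ∀ s ∈ R, ∀ t, Succ π step s t → t ∈ R)
    (hC : ∀ s ∈ R, ∃ c ∈ C, Relation.ReflTransGen (Succ π step) s c)
    (hfin : (e '' (R ∩ C)).Finite) {s : S} (hs : s ∈ R) :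
    ∃ t, Relation.ReflTransGen (Succ π step) s t ∧
      ∀ u, Relation.ReflTransGen (Succ π step) t u →
        ∃ v, e v = e t ∧ Relation.ReflTransGen (Succ π step) u v := by
  have hR' : ∀ {s t}, s ∈ R → Relation.ReflTransGen (Succ π step) s t → t ∈ R := by
    intro s t hs h
    induction h with
    | refl => exact hs
    | tail _ h ih => exact hR _ ih _ h
  -- The set of accessible classes in `R ∩ C` can only shrink along a path. At a state `c` where its
  -- size is minimal it no longer shrinks, so the class of `c` stays accessible.
  let cls : S → Set β := fun c => e '' (R ∩ C ∩ {d | Relation.ReflTransGen (Succ π step) c d})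
  have hcls : ∀ c, (cls c).Finite := fun c => hfin.subset (Set.image_mono Set.inter_subset_left)
  obtain ⟨c, ⟨⟨hcR, hcC⟩, hsc⟩, hmin⟩ :=
    (measure fun c => (cls c).ncard).wf.has_min
      (R ∩ C ∩ {d | Relation.ReflTransGen (Succ π step) s d}) (by
        obtain ⟨c, hc, hr⟩ := hC s hs
        exact ⟨c, ⟨hR' hs hr, hc⟩, hr⟩)
  refine ⟨c, hsc, fun u hu => ?_⟩
  obtain ⟨d, hd, hud⟩ := hC u (hR' hcR hu)
  have hcd := hu.trans hud
  have hsub : cls d ⊆ cls c := Set.image_mono fun v hv => ⟨hv.1, hcd.trans hv.2⟩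
  have hle : (cls c).ncard ≤ (cls d).ncard :=
    not_lt.1 (hmin d ⟨⟨hR' hcR hcd, hd⟩, hsc.trans hcd⟩)
  have heq : cls d = cls c := Set.eq_of_subset_of_ncard_le hsub hle (hcls c)
  obtain ⟨v, hv, hve⟩ : e c ∈ cls d := heq ▸ ⟨c, ⟨⟨hcR, hcC⟩, .refl⟩, rfl⟩
  exact ⟨v, hve, hud.trans hv.2⟩

end Essential

/-! ### Stability -/

section Stability

variable {N : ℕ} {K : ℕ} {lam : Fin N → ℝ} {pick : (Fin N → ℝ) → Fin N}

instance : Countable (State N) := by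
  let ψ : State N → (Fin N → ℕ) × (Fin N → ℕ) × (Fin N → ℕ) × Fin N × ℕ := fun s =>
    (s.backlog, s.seen, s.age, s.incumbent, s.served)
  have hψ : Function.Injective ψ := by
    rintro ⟨⟩ ⟨⟩ h
    simpa [ψ] using h
  exact hψ.countable

theorem chain_eq_drive {Ω : Type*} (A : ℕ → Fin N → Ω → ℕ) :
    chain K lam pick A = drive (State.step K lam pick) fun t ω j => A t j ω := by
  funext x t ω
  induction t with
  | zero => rfl
  | succ t ih => rw [chain, drive, ih]

/-! ### The law of the arrival vectors and the transfer to the queueing chain -/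

section Arrivals

variable {Ω : Type*} [MeasurableSpace Ω] {μ : Measure Ω}
  {A : ℕ → Fin N → Ω → ℕ}

theorem IsBernoulliArrivals.measurable_vector (hA : IsBernoulliArrivals μ lam A) (t : ℕ) :
    Measurable fun ω j => A t j ω :=
  measurable_pi_lambda _ fun j => hA.measurable t j

/-- The past and the next arrival vector are generated by disjoint blocks of the independent family.
-/
theorem IsBernoulliArrivals.indep_past (hA : IsBernoulliArrivals μ lam A) (n : ℕ) :
    Indep (past (fun t ω j => A t j ω) n)
      (MeasurableSpace.comap (fun ω j => A (n + 1) j ω) inferInstance) μ := by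
  have h := indep_iSup_of_disjoint (fun p : ℕ × Fin N => (hA.measurable p.1 p.2).comap_le)
    hA.indep (S := {p | p.1 ≤ n}) (T := {p | p.1 = n + 1})
    (Set.disjoint_left.2 fun p (h1 : p.1 ≤ n) (h2 : p.1 = n + 1) => by omega)
  have hle : ∀ (t : ℕ) (U : Set (ℕ × Fin N)), (∀ j, (t, j) ∈ U) →
      MeasurableSpace.comap (fun ω j => A t j ω) inferInstance
        ≤ ⨆ p ∈ U, MeasurableSpace.comap (A p.1 p.2) inferInstance := by
    intro t U hU
    refine Measurable.comap_le (@measurable_pi_lambda _ _ _ (_) _ _ fun j => ?_)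
    exact Measurable.mono (comap_measurable (A t j))
      (le_biSup (fun p : ℕ × Fin N => MeasurableSpace.comap (A p.1 p.2) inferInstance) (hU j)) le_rfl
  exact indep_of_indep_of_le_left (indep_of_indep_of_le_right h (hle (n + 1) _ fun j => rfl))
    (iSup₂_le fun t ht => hle t _ fun j => ht)

variable [IsProbabilityMeasure μ]

theorem IsBernoulliArrivals.map_eq_bern (hA : IsBernoulliArrivals μ lam A) (h0 : ∀ i, 0 ≤ lam i)
    (t : ℕ) (j : Fin N) : μ.map (A t j) = bern (lam j) := by
  have hm := hA.measurable t j
  have hone : MeasurableSet {ω | A t j ω = 1} := hm (measurableSet_singleton 1)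
  refine Measure.ext_of_singleton fun k => ?_
  rw [Measure.map_apply hm (measurableSet_singleton k),
    ← lintegral_indicator_one (measurableSet_singleton k), lintegral_bern]
  rcases k with _ | _ | k
  · have h : μ (A t j ⁻¹' {0}) = μ {ω | A t j ω = 1}ᶜ := by
      refine le_antisymm (measure_mono_ae ?_) (measure_mono_ae ?_)
      · exact .of_forall fun ω (h1 : A t j ω = 0) (h2 : A t j ω = 1) => by omega
      · filter_upwards [hA.le_one t j] with ω hω (h1 : ¬ A t j ω = 1)
        exact show A t j ω = 0 by omega
    rw [h, prob_compl_eq_one_sub hone, hA.prob_one]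
    simp [ENNReal.ofReal_sub _ (h0 j)]
  · have h : A t j ⁻¹' {0 + 1} = {ω | A t j ω = 1} := rfl
    rw [h, hA.prob_one]
    simp
  · have h : μ (A t j ⁻¹' {k + 1 + 1}) = 0 := by
      refine measure_mono_null (fun ω hω => ?_) (ae_iff.1 (hA.le_one t j))
      have h' : A t j ω = k + 1 + 1 := hω
      exact fun h'' : A t j ω ≤ 1 => by omega
    rw [h]
    simp

theorem IsBernoulliArrivals.map_eq_arrivalLaw (hA : IsBernoulliArrivals μ lam A)
    (h0 : ∀ i, 0 ≤ lam i) (t : ℕ) : μ.map (fun ω j => A t j ω) = arrivalLaw lam := by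
  have hi : iIndepFun (fun j => A t j) μ :=
    hA.indep.precomp (g := fun j : Fin N => (t, j)) fun _ _ h => (Prod.ext_iff.1 h).2
  rw [(iIndepFun_iff_map_fun_eq_pi_map fun j => (hA.measurable t j).aemeasurable).1 hi]
  simp only [hA.map_eq_bern h0]

theorem meanReturnTime_chain (hA : IsBernoulliArrivals μ lam A) (h0 : ∀ i, 0 ≤ lam i)
    (h1 : ∀ i, lam i ≤ 1) (x : State N) (E : Set (State N)) :
    meanReturnTime μ (chain K lam pick A) x E
      = meanHit (arrivalLaw lam) (State.step K lam pick) E x := by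
  have := isProbabilityMeasure_arrivalLaw h0 h1
  rw [chain_eq_drive]
  exact meanReturnTime_drive hA.measurable_vector (hA.map_eq_arrivalLaw h0) hA.indep_past x E

theorem canReach_chain_iff (hA : IsBernoulliArrivals μ lam A) (h0 : ∀ i, 0 ≤ lam i)
    (h1 : ∀ i, lam i ≤ 1) (x : State N) (E : Set (State N)) :
    CanReach μ (chain K lam pick A) x E ↔
      ∃ y ∈ E, Relation.ReflTransGen (Succ (arrivalLaw lam) (State.step K lam pick)) x y := by
  have := isProbabilityMeasure_arrivalLaw h0 h1
  rw [chain_eq_drive]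
  exact canReach_drive_iff hA.measurable_vector (hA.map_eq_arrivalLaw h0) hA.indep_past x E

theorem staysReachable_chain_iff (hA : IsBernoulliArrivals μ lam A) (h0 : ∀ i, 0 ≤ lam i)
    (h1 : ∀ i, lam i ≤ 1) (x : State N) (E : Set (State N)) :
    StaysReachable μ (chain K lam pick A) x E ↔
      ∀ y, Relation.ReflTransGen (Succ (arrivalLaw lam) (State.step K lam pick)) x y →
        ∃ z ∈ E, Relation.ReflTransGen (Succ (arrivalLaw lam) (State.step K lam pick)) y z := by
  simp [StaysReachable, canReach_chain_iff hA h0 h1]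

end Arrivals

/-- A set that is determined by the essential part of the state, and that is accessible from all
states accessible from `x`, is entered in finite mean time from `x`. -/
theorem meanHit_lt_top_of_reach (hK : 1 ≤ K) (h0 : ∀ i, 0 ≤ lam i) (hsum : ∑ i, lam i < 1)
    (h1 : ∀ i, lam i < 1) (hpick : IsArgmax pick) {E : Set (State N)}
    (hE : ∀ s t : State N, s.essentialPart lam = t.essentialPart lam → s ∈ E → t ∈ E)
    {x : State N} (hx : x ∈ stateSpace K lam)
    (hreach : ∀ y, Relation.ReflTransGen (Succ (arrivalLaw lam) (State.step K lam pick)) x y →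
      ∃ z ∈ E, Relation.ReflTransGen (Succ (arrivalLaw lam) (State.step K lam pick)) y z) :
    meanHit (arrivalLaw lam) (State.step K lam pick) E x < ∞ := by
  have := isProbabilityMeasure_arrivalLaw h0 fun i => (h1 i).le
  have hR : ∀ {y}, Relation.ReflTransGen (Succ (arrivalLaw lam) (State.step K lam pick)) x y →
      y ∈ stateSpace K lam := mem_stateSpace_of_reflTransGen hK hx
  refine meanHit_lt_top_of_finite (e := State.essentialPart lam)
    (R := {y | Relation.ReflTransGen (Succ (arrivalLaw lam) (State.step K lam pick)) x y})
    (C := {t | t.maxIndex lam pick ≤ driftLevel N K lam})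
    (fun s t h a => essentialPart_step h a) hE (fun s t h hs => ?_)
    (fun s hs t hst => hs.tail hst)
    (fun s hs => meanHit_maxIndex_lt_top h0 hsum h1 hpick (hR hs))
    ((finite_essentialPart h0 hpick (driftLevel N K lam)).subset
      (Set.image_mono (Set.inter_subset_inter_left _ fun y hy => hR hy)))
    (fun s hs _ => ?_) x .refl
  · have : s.maxIndex lam pick = t.maxIndex lam pick := by
      simp only [State.maxIndex, index_congr h]
    exact this.symm.trans_le hs
  -- Hitting counts only times `n ≥ 1`; a first slot without arrivals makes the path nonempty.
  · have hsucc := succ_step_zero (K := K) (pick := pick) h1 s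
    obtain ⟨z, hz, hr⟩ := hreach _ (hs.tail hsucc)
    exact ⟨z, hz, .head' hsucc hr⟩

variable {Ω : Type*} [MeasurableSpace Ω] {μ : Measure Ω} [IsProbabilityMeasure μ]
  {A : ℕ → Fin N → Ω → ℕ}

theorem positiveRecurrent_chain (hK : 1 ≤ K) (h0 : ∀ i, 0 ≤ lam i) (hsum : ∑ i, lam i < 1)
    (h1 : ∀ i, lam i < 1) (hpick : IsArgmax pick) (hA : IsBernoulliArrivals μ lam A)
    {β : Type*} (f : State N → β)
    (hf : ∀ s t : State N, s.essentialPart lam = t.essentialPart lam → f s = f t) :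
    PositiveRecurrent μ (chain K lam pick A) (stateSpace K lam) f := by
  have h1' := fun i => (h1 i).le
  have := isProbabilityMeasure_arrivalLaw h0 h1'
  constructor
  · intro x hx
    -- Recurrence of the whole essential part is stronger than essentiality for `f`, and it is what
    -- the minimality argument supplies.
    let E : Set (State N) := {y | ∀ u,
      Relation.ReflTransGen (Succ (arrivalLaw lam) (State.step K lam pick)) y u →
        ∃ v, v.essentialPart lam = y.essentialPart lam ∧
          Relation.ReflTransGen (Succ (arrivalLaw lam) (State.step K lam pick)) u v}
    have hsub : E ⊆ {y | StaysReachable μ (chain K lam pick A) y {z | f z = f y}} := by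
      intro y hy
      refine (staysReachable_chain_iff hA h0 h1' _ _).2 fun u hu => ?_
      obtain ⟨v, hv, hr⟩ := hy u hu
      exact ⟨v, hf _ _ hv, hr⟩
    have hE : ∀ s t : State N, s.essentialPart lam = t.essentialPart lam → s ∈ E → t ∈ E := by
      intro s t hst hs u hu
      obtain ⟨u', hu', hr'⟩ := exists_reflTransGen_of_eq (e := State.essentialPart lam)
        (fun s t h a => essentialPart_step h a) hst.symm hu
      obtain ⟨v, hv, hr⟩ := hs u' hr'
      obtain ⟨v', hv', hr''⟩ := exists_reflTransGen_of_eq (e := State.essentialPart lam)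
        (fun s t h a => essentialPart_step h a) hu'.symm hr
      exact ⟨v', hv'.symm.trans (hv.trans hst), hr''⟩
    have hlt : meanReturnTime μ (chain K lam pick A) x E < ∞ := by
      rw [meanReturnTime_chain hA h0 h1']
      refine meanHit_lt_top_of_reach hK h0 hsum h1 hpick hE hx fun y hy => ?_
      obtain ⟨t, hyt, ht⟩ := exists_reach_essential (e := State.essentialPart lam)
        (fun s hs t => mem_stateSpace_of_succ hK hs)
        (fun s hs => exists_reflTransGen_of_meanHit_lt_top
          (meanHit_maxIndex_lt_top h0 hsum h1 hpick hs))
        (finite_essentialPart h0 hpick (driftLevel N K lam))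
        (mem_stateSpace_of_reflTransGen hK hx hy)
      exact ⟨t, ht, hyt⟩
    refine lt_of_le_of_lt (lintegral_mono fun ω => ?_) hlt
    exact iInf_mono fun n => iInf_mono' fun h => ⟨⟨h.1, hsub h.2⟩, le_rfl⟩
  · intro x hx a ha
    rw [meanReturnTime_chain hA h0 h1']
    exact meanHit_lt_top_of_reach hK h0 hsum h1 hpick
      (fun s t h (hs : f s = a) => (hf s t h).symm.trans hs) hx
      ((staysReachable_chain_iff hA h0 h1' _ _).1 ha)

theorem isStable_chain (hK : 1 ≤ K) (h0 : ∀ i, 0 ≤ lam i) (hsum : ∑ i, lam i < 1)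
    (hpick : IsArgmax pick) (hA : IsBernoulliArrivals μ lam A) :
    IsStable μ K lam pick A := by
  have h1 : ∀ i, lam i < 1 := fun i =>
    (Finset.single_le_sum (fun i _ => h0 i) (Finset.mem_univ i)).trans_lt hsum
  have hb : ∀ s t : State N, s.essentialPart lam = t.essentialPart lam → s.backlog = t.backlog :=
    fun s t h => (essentialPart_eq_iff.1 h).1
  refine ⟨fun x hx => ?_, positiveRecurrent_chain hK h0 hsum h1 hpick hA _ hb,
    positiveRecurrent_chain hK h0 hsum h1 hpick hA _ fun _ _ h => h⟩
  rw [meanReturnTime_chain hA h0 fun i => (h1 i).le]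
  exact meanHit_lt_top_of_reach hK h0 hsum h1 hpick
    (fun s t h (hs : s.backlog = 0) => (hb s t h).symm.trans hs) hx
    fun y hy => exists_reach_empty hK h0 hsum h1 hpick (mem_stateSpace_of_reflTransGen hK hx hy)

end Stability

end KLEQ

theorem mainTheorem5 {N : ℕ} [NeZero N] (K : ℕ) (hK : 1 ≤ K)
    (lam : Fin N → ℝ) (hlam : ∀ i, 0 ≤ lam i) (hsum : ∑ i, lam i < 1)
    (pick : (Fin N → ℝ) → Fin N) (hpick : KLEQ.IsArgmax pick)
    {Ω : Type*} [MeasurableSpace Ω] (μ : MeasureTheory.Measure Ω)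
    [MeasureTheory.IsProbabilityMeasure μ]
    (A : ℕ → Fin N → Ω → ℕ) (hA : KLEQ.IsBernoulliArrivals μ lam A) :
    KLEQ.IsStable μ K lam pick A :=
  KLEQ.isStable_chain hK hlam hsum hpick hA
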